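/- Let $n\ge 0$. A positroid of size $n$ is a word $v=v_1v_2\cdots v_n$ consisting, for some $0\le j\le n$, of $j$ copies of the letter $0$ and one copy of each of the letters $1,2,\dots,n-j$. Let $P_n$ be the set of positroids of size $n$ and $\mathbb{C}[P_n]$ the complex vector space with basis $P_n$. For $1\le i\le n-1$ let $s_i=(i,i+1)\in\mathfrak{S}_n$. There is exactly one linear action of $\mathfrak{S}_n$ on $\mathbb{C}[P_n]$ such that, for all $1\le i\le n-1$ and $v\in P_n$, $$ s_i.v=\pm\, v_1\cdots v_{i+1}v_i\cdots v_n, $$ where the sign is $-$ if $v_i=v_{i+1}=0$ and $+$ otherwise. For this action, $$ \mathrm{Frob}(\mathbb{C}[P_n]) = B_{n,n-1}(X;1)=\sum_{j=0}^n e_j(X)\, h_{(1^{n-j})}(X). $$ Here $X=(x_1,x_2,\dots)$ is an infinite list of variables, $e_d(X)$ and $h_d(X)$ are the elementary and homogeneous symmetric functions, $h_\lambda=h_{\lambda_1}h_{\lambda_2}\cdots$ (so $h_{(1^{n-j})}=h_1^{\,n-j}$), and $B_{n,n-1}(X;q):=\sum_{j=0}^n q^j\, e_j(X)\,h_{(1^{n-j})}(X)$.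 The Frobenius image of a finite-dimensional complex $\mathfrak{S}_n$-module $V$ is $\mathrm{Frob}(V):=\sum_{\lambda\vdash n}m_\lambda s_\lambda(X)$, where $s_\lambda(X)=\sum_T x^T$ (sum over semistandard tableaux of shape $\lambda$) is the Schur function, $S^\lambda=\mathbb{C}[\mathfrak{S}_n]\varepsilon_\lambda$ is the irreducible module generated by the Young idempotent $\varepsilon_\lambda=\sum_{w\in R_T}\sum_{u\in C_T}\mathrm{sign}(u)\,uw$ of a standard tableau $T$ of shape $\lambda$ with row and column stabilizers $R_T,C_T$, and $m_\lambda\ge 0$ are the unique integers with $V\cong\bigoplus_{\lambda\vdash n} m_\lambda S^\lambda$. -/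

import Mathlib

noncomputable section

namespace Positroid

/-! ### Partitions

A partition of `n` is identified with its Ferrers diagram, a Young diagram with `n` cells
(cells are pairs (row, column), numbered from `0`). -/

/-- Partitions of `n`, as Young diagrams with `n` cells. -/
abbrev Part (n : ℕ) : Type := {l : YoungDiagram // l.card = n}

theorem cells_subset {n : ℕ} (l : Part n) :
    l.1.cells ⊆ Finset.range n ×ˢ Finset.range n := by
  rintro ⟨i, j⟩ h
  have h' : (i, j) ∈ l.1 := (YoungDiagram.mem_cells _).1 h
  have hrow : (l.1.row i).card ≤ n :=
    (Finset.card_le_card (Finset.filter_subset _ _)).trans l.2.le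
  have hcol : (l.1.col j).card ≤ n :=
    (Finset.card_le_card (Finset.filter_subset _ _)).trans l.2.le
  rw [← YoungDiagram.rowLen_eq_card] at hrow
  rw [← YoungDiagram.colLen_eq_card] at hcol
  have h1 := YoungDiagram.mem_iff_lt_rowLen.1 h'
  have h2 := YoungDiagram.mem_iff_lt_colLen.1 h'
  simp only [Finset.mem_product, Finset.mem_range]
  omega

instance instFinitePart (n : ℕ) : Finite (Part n) := by
  refine Finite.of_injective
    (fun l : Part n => (⟨l.1.cells, Finset.mem_powerset.2 (cells_subset l)⟩ :
      {s // s ∈ (Finset.range n ×ˢ Finset.range n).powerset})) ?_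
  intro a b h
  exact Subtype.ext (YoungDiagram.ext (Subtype.mk.inj h))

instance instFintypePart (n : ℕ) : Fintype (Part n) := Fintype.ofFinite _

/-! ### Symmetric functions

Symmetric functions are formal power series over `ℂ` in the infinitely many variables
`x_0, x_1, x_2, …`, described by their coefficients. -/

open Classical in
/-- The elementary symmetric function `e_d`: the sum of all squarefree monomials of degree `d`. -/
def esymm (d : ℕ) : MvPowerSeries ℕ ℂ :=
  fun m => if (∀ i, m i ≤ 1) ∧ m.degree = d then 1 else 0

/-- The homogeneous symmetric function `h_d`: the sum of all monomials of degree `d`. -/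
def hsymm (d : ℕ) : MvPowerSeries ℕ ℂ :=
  fun m => if m.degree = d then 1 else 0

/-- `h_λ = h_{λ_1} h_{λ_2} ⋯` for a multiset `λ` of parts. -/
def hsymmPart (parts : Multiset ℕ) : MvPowerSeries ℕ ℂ :=
  (parts.map hsymm).prod

/-- The Schur function `s_λ = ∑_T x^T`: the coefficient of the monomial `x^m` is the number of
semistandard tableaux of shape `λ` in which every letter `i` occurs exactly `m i` times. -/
def schur (l : YoungDiagram) : MvPowerSeries ℕ ℂ :=
  fun m => (Set.ncard {T : SemistandardYoungTableau l |
    ∀ i, (l.cells.filter fun c => T c.1 c.2 = i).card = m i} : ℂ)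

/-- `B_{n,n-1}(X;q) = ∑_{j=0}^n q^j e_j h_{(1^{n-j})}`. -/
def boolB (n : ℕ) (q : ℂ) : MvPowerSeries ℕ ℂ :=
  ∑ j ∈ Finset.range (n + 1), q ^ j • (esymm j * hsymmPart (Multiset.replicate (n - j) 1))

/-! ### Irreducible modules of the symmetric group and the Frobenius image -/

/-- The symmetric group on `n` letters. -/
abbrev SymGrp (n : ℕ) : Type := Equiv.Perm (Fin n)

/-- The group algebra of the symmetric group. -/
abbrev GrpAlg (n : ℕ) : Type := MonoidAlgebra ℂ (SymGrp n)

/-- The row-reading standard tableau of shape `l`, given as the map from entries to cells: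
the cells are filled with `0, …, n-1` from left to right in each row, rows from top to bottom. -/
def cellOf {n : ℕ} (l : Part n) (k : Fin n) : ℕ × ℕ :=
  ofLex ((l.1.cells.map (toLex (α := ℕ × ℕ)).toEmbedding).orderEmbOfFin
    ((Finset.card_map _).trans l.2) k)

open Classical in
/-- The Young idempotent `ε_λ = ∑_{w ∈ R_T} ∑_{u ∈ C_T} sign(u) u w`, where `T` is the row-reading
tableau and `R_T`, `C_T` are its row and column stabilizers. -/
def youngElt {n : ℕ} (l : Part n) : GrpAlg n :=
  ∑ w : SymGrp n with (∀ k, (cellOf l (w k)).1 = (cellOf l k).1),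
    ∑ u : SymGrp n with (∀ k, (cellOf l (u k)).2 = (cellOf l k).2),
      ((Equiv.Perm.sign u : ℤ) : ℂ) • MonoidAlgebra.of ℂ (SymGrp n) (u * w)

/-- The irreducible module `S^λ = ℂ[S_n] ε_λ`, a left ideal of the group algebra. -/
abbrev Specht {n : ℕ} (l : Part n) : Submodule (GrpAlg n) (GrpAlg n) :=
  Submodule.span (GrpAlg n) {youngElt l}

/-- `m` is a family of multiplicities for the `S_n`-module `V`: there is an isomorphism
`V ≅ ⨁_λ m_λ S^λ` of modules over the group algebra. -/
def IsMultiplicity {n : ℕ} {V : Type*} [AddCommGroup V] [Module ℂ V]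
    (ρ : Representation ℂ (SymGrp n) V) (m : Part n → ℕ) : Prop :=
  Nonempty (ρ.asModule ≃ₗ[GrpAlg n] ((l : Part n) → Fin (m l) → Specht l))

open Classical in
/-- The Frobenius image `Frob(V) = ∑_λ m_λ s_λ`, where `V ≅ ⨁_λ m_λ S^λ`. (The value `0` is only a
default for modules without such a decomposition, that is, infinite-dimensional ones.) -/
def frob {n : ℕ} {V : Type*} [AddCommGroup V] [Module ℂ V]
    (ρ : Representation ℂ (SymGrp n) V) : MvPowerSeries ℕ ℂ :=
  if h : ∃ m, IsMultiplicity ρ m then ∑ l, (h.choose l : ℂ) • schur l.1 else 0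

/-! ### Positroids and the signed action -/

/-- A word `v` of length `n` is a positroid if, for some `0 ≤ j ≤ n`, it has `j` letters `0` and
one copy of each of the letters `1, …, n - j` (these `n` letters exhaust the word). -/
def IsPositroid {n : ℕ} (v : Fin n → ℕ) : Prop :=
  ∃ j ≤ n, (Finset.univ.filter fun i => v i = 0).card = j ∧
    ∀ a, 1 ≤ a → a ≤ n - j → (Finset.univ.filter fun i => v i = a).card = 1

/-- The set `P_n` of positroids of size `n`. -/
abbrev P (n : ℕ) : Type := {v : Fin n → ℕ // IsPositroid v}

theorem IsPositroid.comp {n : ℕ} {v : Fin n → ℕ} (hv : IsPositroid v) (w : SymGrp n) :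
    IsPositroid (v ∘ w) := by
  have key : ∀ a, (Finset.univ.filter fun i => (v ∘ w) i = a).card
      = (Finset.univ.filter fun i => v i = a).card := fun a =>
    Finset.card_bij (fun i _ => w i) (by simp) (fun _ _ _ _ h => w.injective h)
      (fun b hb => ⟨w.symm b, by simpa using hb, by simp⟩)
  obtain ⟨j, hj, h0, h1⟩ := hv
  exact ⟨j, hj, (key 0).trans h0, fun a ha ha' => (key a).trans (h1 a ha ha')⟩

/-- The adjacent transposition exchanging positions `i` and `i + 1` (numbered from `0`). -/
def adj {n : ℕ} (i : ℕ) (hi : i + 1 < n) : SymGrp n :=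
  Equiv.swap ⟨i, Nat.lt_of_succ_lt hi⟩ ⟨i + 1, hi⟩

/-- The word obtained from `v` by exchanging the letters in positions `i` and `i + 1`. -/
def swapLetters {n : ℕ} (i : ℕ) (hi : i + 1 < n) (v : P n) : P n :=
  ⟨v.1 ∘ adj i hi, v.2.comp _⟩

/-- A linear action of `S_n` on `ℂ[P_n]` is the signed one if each adjacent transposition sends
`v` to `± v_1 … v_{i+1} v_i … v_n`, with the sign `-` exactly when `v_i = v_{i+1} = 0`. -/
def IsSignedAction {n : ℕ} (ρ : Representation ℂ (SymGrp n) (P n →₀ ℂ)) : Prop :=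
  ∀ (i : ℕ) (hi : i + 1 < n) (v : P n),
    ρ (adj i hi) (Finsupp.single v 1) =
      if v.1 ⟨i, Nat.lt_of_succ_lt hi⟩ = 0 ∧ v.1 ⟨i + 1, hi⟩ = 0
      then -Finsupp.single (swapLetters i hi v) 1
      else Finsupp.single (swapLetters i hi v) 1

end Positroid

end

noncomputable section

namespace Positroid

open scoped ENNReal
open Classical
open Finsupp (single)

/-! ### Interlacing partitions and the count of words -/

/-! The two symmetric functions are compared coefficient by coefficient. For a finite-dimensional
module, the coefficient of `x^m` in the Frobenius image is the dimension of the space fixed by the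
Young subgroup `stab f`, where `f` is any labelling of the positions with content `m`
(`coeff_frob`). This rests on Young's rule: the fixed space in `S^λ` has dimension `K_{λ,m}`, a
Kostka number.

Young's rule comes from a sandwich: `∑ K_{λ,m} K_{λ,1^n} ≤ ∑ dim S^λ · dim (S^λ)^{stab f} ≤ dim
ℂ[S_n]^{stab f} ≤ #{words of content m} ≤ ∑ K_{λ,m} K_{λ,1^n}`. The first inequality exhibits
independent invariants indexed by semistandard tableaux (`kostka_le_finrank`). The second is the
density theorem for the pairwise non-isomorphic simple modules `S^λ` (`isSimpleModule_specht`,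
`eq_of_specht_equiv`, `invariantsAction_surjective`). The third counts cosets. The last is one half
of RSK (`card_word_le_sum_kostka`), derived from the commutation of adding a cell with removing a
horizontal strip (`addSum_stripSum`). Equality holds throughout. For injective `f` it shows that
`ℂ[S_n]` acts faithfully on the sum of the `S^λ`, so these exhaust the simple modules and the
multiplicities exist.

The signed action is the permutation of positions twisted by the sign character and conjugated by
the diagonal matrix of inversion signs `invSign`: an adjacent transposition reverses the inversion
sign exactly when the two letters differ, and the only letter that can repeat is `0`. Uniqueness
holds because adjacent transpositions generate. After undoing the conjugation, a vector fixed by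
`stab f` is a function on words that alternates under `stab f`. It vanishes on words in which two
zeros share a label; on the others `stab f` acts freely, so each orbit contributes one dimension. An
orbit is recorded by the set of labels of the zeros and the word of labels of the letters `1, …, n -
j`, and such pairs are what the coefficient of `e_j h_1^{n-j}` counts. -/

/-- `l / k` is a horizontal strip, for partitions given as finitely supported row lengths. -/
def Interlace (l k : ℕ →₀ ℕ) : Prop := ∀ i, k i ≤ l i ∧ l (i + 1) ≤ k i

theorem Interlace.antitone_left {l k : ℕ →₀ ℕ} (h : Interlace l k) : Antitone l :=
  antitone_nat_of_succ_le fun i => (h i).2.trans (h i).1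

theorem Interlace.antitone_right {l k : ℕ →₀ ℕ} (h : Interlace l k) : Antitone k :=
  antitone_nat_of_succ_le fun i => (h (i + 1)).1.trans (h i).2

theorem Interlace.degree_le {l k : ℕ →₀ ℕ} (h : Interlace l k) : k.degree ≤ l.degree := by
  have : k ≤ l := fun i => (h i).1
  rw [← tsub_add_cancel_of_le this, map_add]
  omega

theorem degree_sub_single {k : ℕ →₀ ℕ} {i : ℕ} (h : 1 ≤ k i) :
    (k - single i 1).degree + 1 = k.degree := by
  have : single i 1 ≤ k := by simpa [Finsupp.single_le_iff] using h
  conv_rhs => rw [← tsub_add_cancel_of_le this, map_add]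
  simp

theorem degree_add_single (k : ℕ →₀ ℕ) (i : ℕ) : (k + single i 1).degree = k.degree + 1 := by
  simp [map_add]

theorem interlace_add_zero {l k : ℕ →₀ ℕ} (h : Interlace l k) : Interlace (l + single 0 1) k := by
  intro j
  have := h j
  simp only [Finsupp.add_apply, Finsupp.single_apply]
  constructor
  · omega
  · simpa using this.2

/-- When `l / k` is already a horizontal strip, both sides reduce to `l (i + 1) < k i`. Addable rows
of `l` are thus matched with removable rows of `k`, shifted by one, and row `0` of `l` is left over.
-/
theorem interlace_add_succ_iff {l k : ℕ →₀ ℕ} (h : Interlace l k) (i : ℕ) :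
    Interlace (l + single (i + 1) 1) k ↔ 1 ≤ k i ∧ Interlace l (k - single i 1) := by
  constructor
  · intro h'
    have h1 := (h' i).2
    simp only [Finsupp.add_apply, Finsupp.single_eq_same] at h1
    refine ⟨by omega, fun j => ?_⟩
    have := h j
    simp only [Finsupp.coe_tsub, Pi.sub_apply, Finsupp.single_apply]
    split_ifs with hij
    · subst hij; omega
    · omega
  · rintro ⟨h1, h'⟩ j
    have := h j
    have h2 := (h' j).2
    simp only [Finsupp.coe_tsub, Pi.sub_apply, Finsupp.add_apply, Finsupp.single_apply] at h2 ⊢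
    constructor
    · omega
    · split_ifs with h3
      · have : i = j := by omega
        subst this
        simp at h2
        omega
      · omega

/-- Both sides say that the only obstruction to interlacing is `k i = l i + 1` in row `i`. The
remaining inequalities follow from monotonicity of `l` and `k`, so here the matching of rows has no
shift. -/
theorem interlace_add_iff_of_not {l k : ℕ →₀ ℕ} (hl : Antitone l) (hk : Antitone k)
    (h : ¬ Interlace l k) (i : ℕ) :
    Interlace (l + single i 1) k ↔ 1 ≤ k i ∧ Interlace l (k - single i 1) := by
  constructor
  · intro h'
    have key : ∀ j, l (j + 1) ≤ k j := fun j => by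
      have := (h' j).2
      simp only [Finsupp.add_apply] at this
      omega
    have hi : l i < k i := by
      by_contra hc
      refine h fun j => ⟨?_, key j⟩
      have := (h' j).1
      simp only [Finsupp.add_apply, Finsupp.single_apply] at this
      split_ifs at this with hij
      · subst hij; omega
      · omega
    refine ⟨by omega, fun j => ?_⟩
    have h1 := h' j
    simp only [Finsupp.coe_tsub, Pi.sub_apply, Finsupp.add_apply, Finsupp.single_apply] at h1 ⊢
    have h2 := hl (Nat.le_succ j)
    split_ifs at h1 ⊢ <;> simp_all <;> omega
  · rintro ⟨h1, h'⟩
    have key : ∀ j, l (j + 1) ≤ k j := fun j => by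
      have := (h' j).2
      simp only [Finsupp.coe_tsub, Pi.sub_apply] at this
      omega
    have hi : l i < k i := by
      by_contra hc
      refine h fun j => ⟨?_, key j⟩
      have := (h' j).1
      simp only [Finsupp.coe_tsub, Pi.sub_apply, Finsupp.single_apply] at this
      split_ifs at this with hij
      · subst hij; omega
      · omega
    intro j
    have h2 := h' j
    have h3 := hk (Nat.le_succ j)
    simp only [Finsupp.coe_tsub, Pi.sub_apply, Finsupp.add_apply, Finsupp.single_apply] at h2 ⊢
    constructor
    · split_ifs at h2 ⊢ <;> omega
    · split_ifs at h2 ⊢ with h4 h5 h5 <;> try omega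
      subst h4
      simp only [Nat.succ_eq_add_one] at h3
      omega

theorem tsum_add_single (i : ℕ) (g : (ℕ →₀ ℕ) → (ℕ →₀ ℕ) → ℝ≥0∞) :
    ∑' k, g (k + single i 1) k = ∑' k, if 1 ≤ k i then g k (k - single i 1) else 0 := by
  rw [← Function.Injective.tsum_eq (g := fun k : ℕ →₀ ℕ => k + single i 1)
    (f := fun k => if 1 ≤ k i then g k (k - single i 1) else 0) (add_left_injective _)]
  · refine tsum_congr fun k => ?_
    simp
  · intro k hk
    have h1 : 1 ≤ k i := by
      by_contra h
      simp [h] at hk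
    exact ⟨k - single i 1, tsub_add_cancel_of_le (by simpa [Finsupp.single_le_iff] using h1)⟩

/-- Sum of `a` over all ways to remove a horizontal strip of size `m`. -/
def stripSum (m : ℕ) (a : (ℕ →₀ ℕ) → ℝ≥0∞) (l : ℕ →₀ ℕ) : ℝ≥0∞ :=
  ∑' k, if Interlace l k ∧ l.degree = k.degree + m then a k else 0

/-- Sum of `a` over all ways to add a cell. -/
def addSum (a : (ℕ →₀ ℕ) → ℝ≥0∞) (l : ℕ →₀ ℕ) : ℝ≥0∞ := ∑' i, a (l + single i 1)

/-- The commutation relation behind RSK. For a fixed inner shape `k`, adding a cell to `l` is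
matched with removing one from `k`; the sole unmatched case, a cell in row `0` of `l`, produces the
strip of size `m - 1`. Values in `ℝ≥0∞` allow the sums to be exchanged freely. -/
theorem addSum_stripSum (m : ℕ) (a : (ℕ →₀ ℕ) → ℝ≥0∞) (ha : ∀ k, a k ≠ 0 → Antitone k)
    {l : ℕ →₀ ℕ} (hl : Antitone l) :
    addSum (stripSum m a) l =
      stripSum m (addSum a) l + if m = 0 then 0 else stripSum (m - 1) a l := by
  have e1 : addSum (stripSum m a) l = ∑' k, ∑' i,
      if Interlace (l + single i 1) k ∧ l.degree + 1 = k.degree + m then a k else 0 := by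
    rw [ENNReal.tsum_comm]
    simp only [addSum, stripSum, degree_add_single]
  have e2 : stripSum m (addSum a) l = ∑' k, ∑' i,
      if (1 ≤ k i ∧ Interlace l (k - single i 1)) ∧ l.degree + 1 = k.degree + m
        then a k else 0 := by
    rw [ENNReal.tsum_comm]
    have : stripSum m (addSum a) l = ∑' k, ∑' i,
        if Interlace l k ∧ l.degree = k.degree + m then a (k + single i 1) else 0 := by
      refine tsum_congr fun k => ?_
      split_ifs <;> simp [addSum]
    rw [this, ENNReal.tsum_comm]
    refine tsum_congr fun i => ?_
    rw [tsum_add_single i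
      (fun k k' => if Interlace l k' ∧ l.degree = k'.degree + m then a k else 0)]
    refine tsum_congr fun k => ?_
    by_cases h : 1 ≤ k i
    · have := degree_sub_single h
      rw [if_pos h]
      congr 1
      simp only [h, true_and, eq_iff_iff]
      refine and_congr_right fun _ => ?_
      omega
    · simp [h]
  have e3 : (if m = 0 then 0 else stripSum (m - 1) a l) =
      ∑' k, if Interlace l k ∧ l.degree + 1 = k.degree + m then a k else 0 := by
    split_ifs with hm
    · symm
      simp only [ENNReal.tsum_eq_zero]
      intro k
      rw [if_neg]
      rintro ⟨h, h'⟩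
      have := h.degree_le
      omega
    · refine tsum_congr fun k => ?_
      congr 1
      simp only [eq_iff_iff]
      refine and_congr_right fun _ => ?_
      omega
  rw [e1, e2, e3, ← ENNReal.tsum_add]
  refine tsum_congr fun k => ?_
  by_cases hk : Antitone k
  swap
  · have : a k = 0 := by
      by_contra h
      exact hk (ha k h)
    simp [this]
  by_cases hd : l.degree + 1 = k.degree + m
  swap
  · simp [hd]
  simp only [hd, and_true]
  by_cases h : Interlace l k
  -- Row `0` is always addable and gives the extra term; row `i + 1` on the left pairs with row `i`
  -- on the right.
  · rw [tsum_eq_zero_add' ENNReal.summable, if_pos (interlace_add_zero h), if_pos h, add_comm]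
    simp only [interlace_add_succ_iff h]
  · simp only [interlace_add_iff_of_not hl hk h, if_neg h, add_zero]

/-- The number of chains of `N` horizontal strips of sizes `m 0, m 1, …` ending in `l`. -/
def chains (m : ℕ → ℕ) : ℕ → (ℕ →₀ ℕ) → ℝ≥0∞
  | 0, l => if l = 0 then 1 else 0
  | N + 1, l => stripSum (m N) (chains m N) l

theorem exists_of_stripSum_ne_zero {m : ℕ} {a : (ℕ →₀ ℕ) → ℝ≥0∞} {l : ℕ →₀ ℕ}
    (h : stripSum m a l ≠ 0) : ∃ k, Interlace l k ∧ l.degree = k.degree + m ∧ a k ≠ 0 := by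
  by_contra! hc
  refine h (ENNReal.tsum_eq_zero.2 fun k => ?_)
  split_ifs with h'
  · exact hc k h'.1 h'.2
  · rfl

theorem antitone_of_chains_ne_zero {m : ℕ → ℕ} {N : ℕ} {l : ℕ →₀ ℕ} (h : chains m N l ≠ 0) :
    Antitone l := by
  cases N with
  | zero =>
    have : l = 0 := by
      by_contra h'
      simp [chains, h'] at h
    subst this
    exact fun _ _ _ => le_rfl
  | succ N =>
    obtain ⟨k, hk, -⟩ := exists_of_stripSum_ne_zero h
    exact hk.antitone_left

theorem degree_of_chains_ne_zero {m : ℕ → ℕ} {N : ℕ} {l : ℕ →₀ ℕ} (h : chains m N l ≠ 0) :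
    l.degree = ∑ i ∈ Finset.range N, m i := by
  induction N generalizing l with
  | zero =>
    have : l = 0 := by
      by_contra h'
      simp [chains, h'] at h
    simp [this]
  | succ N ih =>
    obtain ⟨k, hk, hd, h'⟩ := exists_of_stripSum_ne_zero h
    rw [hd, ih h', Finset.sum_range_succ]

theorem chains_congr {m m' : ℕ → ℕ} {N : ℕ} (h : ∀ i < N, m i = m' i) :
    chains m N = chains m' N := by
  induction N with
  | zero => rfl
  | succ N ih =>
    ext l
    simp only [chains]
    rw [ih fun i hi => h i (by omega), h N (by omega)]

/-- Moving the added cell inward through the strips one at a time, each commutation leaves a term in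
which one letter has lost an occurrence; at the empty shape nothing remains. -/
theorem addSum_chains (m : ℕ →₀ ℕ) (N : ℕ) {l : ℕ →₀ ℕ} (hl : Antitone l) :
    addSum (chains m N) l =
      ∑ k ∈ Finset.range N, if m k = 0 then 0 else chains ⇑(m - single k 1 : ℕ →₀ ℕ) N l := by
  induction N generalizing l with
  | zero =>
    simp only [addSum, chains, Finset.range_zero, Finset.sum_empty, ENNReal.tsum_eq_zero]
    intro i
    rw [if_neg]
    intro h
    simpa using DFunLike.congr_fun h i
  | succ N ih =>
    have : addSum (chains m (N + 1)) l = addSum (stripSum (m N) (chains m N)) l := rfl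
    rw [this, addSum_stripSum _ _ (fun k => antitone_of_chains_ne_zero) hl,
      Finset.sum_range_succ]
    congr 1
    · have : stripSum (m N) (addSum (chains m N)) l = ∑' k, ∑ j ∈ Finset.range N,
          if Interlace l k ∧ l.degree = k.degree + m N then
            (if m j = 0 then 0 else chains ⇑(m - single j 1 : ℕ →₀ ℕ) N k) else 0 := by
        refine tsum_congr fun k => ?_
        split_ifs with h
        · exact ih h.1.antitone_right
        · simp
      rw [this, Summable.tsum_finsetSum fun _ _ => ENNReal.summable]
      refine Finset.sum_congr rfl fun j hj => ?_
      split_ifs with h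
      · simp
      · simp only [chains, stripSum]
        have : (m - single j 1 : ℕ →₀ ℕ) N = m N := by
          have : j ≠ N := (Finset.mem_range.1 hj).ne
          simp [this]
        rw [this]
    · split_ifs with h
      · rfl
      · have e1 : chains ⇑(m - single N 1 : ℕ →₀ ℕ) N = chains m N :=
          chains_congr fun i hi => by simp [hi.ne']
        have e2 : (m - single N 1 : ℕ →₀ ℕ) N = m N - 1 := by simp
        change _ = stripSum ((m - single N 1 : ℕ →₀ ℕ) N) (chains ⇑(m - single N 1 : ℕ →₀ ℕ) N) l
        rw [e1, e2]

/-- The number of standard tableaux of shape `l` with `n` cells, built cell by cell. -/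
def stdCount : ℕ → (ℕ →₀ ℕ) → ℝ≥0∞
  | 0, l => if l = 0 then 1 else 0
  | n + 1, l => ∑' i, if 1 ≤ l i ∧ Antitone l then stdCount n (l - single i 1) else 0

theorem antitone_of_stdCount_ne_zero {n : ℕ} {l : ℕ →₀ ℕ} (h : stdCount n l ≠ 0) :
    Antitone l := by
  cases n with
  | zero =>
    have : l = 0 := by
      by_contra h'
      simp [stdCount, h'] at h
    subst this
    exact fun _ _ _ => le_rfl
  | succ N =>
    by_contra hc
    simp [stdCount, hc] at h

theorem interlace_sub_single {l : ℕ →₀ ℕ} {i : ℕ} (hl : Antitone l)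
    (h : Antitone ⇑(l - single i 1 : ℕ →₀ ℕ)) : Interlace l (l - single i 1) := by
  intro j
  have h1 := h (Nat.le_succ j)
  have h2 := hl (Nat.le_succ j)
  simp only [Finsupp.coe_tsub, Pi.sub_apply, Finsupp.single_apply, Nat.succ_eq_add_one] at *
  refine ⟨by omega, ?_⟩
  split_ifs at * <;> omega

/-- Removing one cell removes a horizontal strip of size one, and different rows give different
inner shapes. Only this direction is needed for the sandwich. -/
theorem stdCount_le_chains (n : ℕ) (l : ℕ →₀ ℕ) : stdCount n l ≤ chains (fun _ => 1) n l := by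
  induction n generalizing l with
  | zero => exact le_rfl
  | succ n ih =>
    set F : (ℕ →₀ ℕ) → ℝ≥0∞ := fun k =>
      if Interlace l k ∧ l.degree = k.degree + 1 then chains (fun _ => 1) n k else 0
    have h1 : stdCount (n + 1) l ≤ ∑' i : {i // 1 ≤ l i}, F (l - single i.1 1) := by
      have : stdCount (n + 1) l = ∑' i : {i // 1 ≤ l i},
          if 1 ≤ l i.1 ∧ Antitone l then stdCount n (l - single i.1 1) else 0 := by
        refine (tsum_subtype_eq_of_support_subset (s := {i | 1 ≤ l i}) ?_).symm
        intro i hi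
        by_contra hc
        simp only [Set.mem_ofPred_eq] at hc
        simp [hc] at hi
      rw [this]
      refine ENNReal.tsum_le_tsum fun i => ?_
      split_ifs with h
      · by_cases h0 : stdCount n (l - single i.1 1) = 0
        · simp [h0]
        · have h2 := interlace_sub_single h.2 (antitone_of_stdCount_ne_zero h0)
          have h3 := degree_sub_single i.2
          simp only [F]
          rw [if_pos ⟨h2, h3.symm⟩]
          exact ih _
      · exact zero_le
    refine h1.trans ?_
    refine ENNReal.tsum_comp_le_tsum_of_injective
      (f := fun i : {i // 1 ≤ l i} => l - single i.1 1) ?_ F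
    rintro ⟨i, hi⟩ ⟨j, hj⟩ h
    by_contra hne
    have hne : i ≠ j := fun h => hne (Subtype.ext h)
    have := DFunLike.congr_fun h i
    simp [hne.symm] at this
    omega

/-- Adding a cell is adjoint to removing one, so the last cell of the standard tableau is
transferred to the chain, where `addSum_chains` applies. The result is the recursion satisfied by
words on removing their first letter. -/
theorem tsum_chains_mul_stdCount_succ (m : ℕ →₀ ℕ) (N n : ℕ) :
    ∑' l, chains m N l * stdCount (n + 1) l = ∑ k ∈ Finset.range N,
      if m k = 0 then 0 else ∑' l, chains ⇑(m - single k 1 : ℕ →₀ ℕ) N l * stdCount n l := by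
  have e1 : ∑' l, chains m N l * stdCount (n + 1) l =
      ∑' i, ∑' l : ℕ →₀ ℕ, if 1 ≤ l i then chains m N l * stdCount n (l - single i 1) else 0 := by
    rw [ENNReal.tsum_comm]
    refine tsum_congr fun l => ?_
    simp only [stdCount, ← ENNReal.tsum_mul_left]
    refine tsum_congr fun i => ?_
    by_cases h0 : chains m N l = 0
    · simp [h0]
    · simp [antitone_of_chains_ne_zero h0]
  rw [e1]
  simp only [← tsum_add_single _ (fun l l' => chains m N l * stdCount n l')]
  rw [ENNReal.tsum_comm]
  simp only [ENNReal.tsum_mul_right]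
  have e2 : ∀ l, (∑' i, chains m N (l + single i 1)) * stdCount n l =
      ∑ k ∈ Finset.range N,
        if m k = 0 then 0 else chains ⇑(m - single k 1 : ℕ →₀ ℕ) N l * stdCount n l := by
    intro l
    by_cases h0 : stdCount n l = 0
    · simp [h0]
    · have := addSum_chains m N (antitone_of_stdCount_ne_zero h0)
      rw [addSum] at this
      rw [this, Finset.sum_mul]
      refine Finset.sum_congr rfl fun k _ => ?_
      split_ifs <;> simp
  rw [tsum_congr e2, Summable.tsum_finsetSum fun _ _ => ENNReal.summable]
  refine Finset.sum_congr rfl fun k _ => ?_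
  split_ifs <;> simp

theorem chains_zero_apply_zero {m : ℕ → ℕ} (N : ℕ) (h : ∀ i, m i = 0) : 1 ≤ chains m N 0 := by
  induction N with
  | zero => simp [chains]
  | succ N ih =>
    refine ih.trans ?_
    simp only [chains, stripSum]
    refine le_trans ?_ (ENNReal.le_tsum 0)
    rw [if_pos]
    exact ⟨fun i => by simp, by simp [h]⟩

/-! ### Words of given content -/

/-- The words of length `n` in which each letter `i` occurs `m i` times. -/
abbrev Word (n : ℕ) (m : ℕ →₀ ℕ) : Type :=
  {a : Fin n → ℕ // ∀ i, (Finset.univ.filter fun k => a k = i).card = m i}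

instance (n : ℕ) (m : ℕ →₀ ℕ) : Finite (Word n m) := by
  refine Finite.of_injective
    (fun a : Word n m => fun k => (⟨a.1 k, ?_⟩ : {i // i ∈ m.support})) ?_
  · rw [Finsupp.mem_support_iff, ← a.2, Finset.card_ne_zero]
    exact ⟨k, by simp⟩
  · intro a b h
    ext k
    exact congrArg Subtype.val (congrFun h k)

theorem card_filter_cons {n : ℕ} (x : ℕ) (a : Fin n → ℕ) (i : ℕ) :
    (Finset.univ.filter fun k => (Fin.cons x a : Fin (n + 1) → ℕ) k = i).card =
      (if x = i then 1 else 0) + (Finset.univ.filter fun k => a k = i).card := by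
  simp only [Finset.card_filter, Fin.sum_univ_succ, Fin.cons_zero, Fin.cons_succ]

/-- Removing the first letter of a word. -/
def wordSuccEquiv (n : ℕ) (m : ℕ →₀ ℕ) :
    Word (n + 1) m ≃ Σ k : {k // k ∈ m.support}, Word n (m - single k.1 1) where
  toFun a := ⟨⟨a.1 0, by
    rw [Finsupp.mem_support_iff, ← a.2, Finset.card_ne_zero]
    exact ⟨0, by simp⟩⟩, ⟨Fin.tail a.1, fun i => by
      have := card_filter_cons (a.1 0) (Fin.tail a.1) i
      rw [Fin.cons_self_tail, a.2] at this
      simp only [Finsupp.coe_tsub, Pi.sub_apply, Finsupp.single_apply]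
      omega⟩⟩
  invFun p := ⟨Fin.cons p.1.1 p.2.1, fun i => by
    have h := Finsupp.mem_support_iff.1 p.1.2
    rw [card_filter_cons, p.2.2]
    simp only [Finsupp.coe_tsub, Pi.sub_apply, Finsupp.single_apply]
    split_ifs with h'
    · rw [h'] at h; omega
    · omega⟩
  left_inv a := by
    ext k
    simp
  right_inv p := by
    obtain ⟨⟨k, hk⟩, ⟨a, ha⟩⟩ := p
    rfl

theorem card_word_succ (n : ℕ) (m : ℕ →₀ ℕ) :
    Nat.card (Word (n + 1) m) = ∑ k ∈ m.support, Nat.card (Word n (m - single k 1)) := by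
  rw [Nat.card_congr (wordSuccEquiv n m), Nat.card_sigma,
    Finset.sum_coe_sort m.support fun k => Nat.card (Word n (m - single k 1))]

theorem card_word_zero (m : ℕ →₀ ℕ) : Nat.card (Word 0 m) = if m = 0 then 1 else 0 := by
  split_ifs with h
  · subst h
    have : Unique (Word 0 0) := ⟨⟨⟨finZeroElim, by simp⟩⟩, fun a => Subsingleton.elim _ _⟩
    exact Nat.card_unique
  · have : IsEmpty (Word 0 m) := ⟨fun a => h (by ext i; simpa using (a.2 i).symm)⟩
    exact Nat.card_of_isEmpty

theorem card_word_le (n N : ℕ) (m : ℕ →₀ ℕ) (hm : ∀ i, N ≤ i → m i = 0) :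
    (Nat.card (Word n m) : ℝ≥0∞) ≤ ∑' l, chains m N l * stdCount n l := by
  induction n generalizing m with
  | zero =>
    rw [card_word_zero]
    split_ifs with h
    · refine le_trans ?_ (ENNReal.le_tsum 0)
      have := chains_zero_apply_zero (m := m) N (by simp [h])
      simpa [stdCount] using this
    · simp
  | succ n ih =>
    rw [card_word_succ, tsum_chains_mul_stdCount_succ]
    push_cast
    have : m.support = (Finset.range N).filter fun k => m k ≠ 0 := by
      ext k
      simp only [Finsupp.mem_support_iff, Finset.mem_filter, Finset.mem_range]
      refine ⟨fun h => ⟨?_, h⟩, fun h => h.2⟩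
      by_contra hc
      exact h (hm k (by omega))
    rw [this, Finset.sum_filter]
    refine Finset.sum_le_sum fun k _ => ?_
    by_cases h : m k = 0
    · simp [h]
    · simp only [h, ne_eq, not_false_eq_true, if_true, if_false]
      refine ih _ fun i hi => ?_
      simp [hm i hi]

end Positroid
end

noncomputable section

namespace Positroid

open scoped ENNReal
open Classical
open Finsupp (single)

/-! ### Tableaux from chains of horizontal strips -/

/-- The Young diagram with row lengths `l` (for antitone `l`). -/
def diagram (l : ℕ →₀ ℕ) : YoungDiagram where
  -- The condition on all rows above makes this a lower set for every `l`; for antitone `l` the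
  -- condition on the row itself suffices.
  cells := (l.support ×ˢ Finset.range (l 0)).filter fun c => ∀ i ≤ c.1, c.2 < l i
  isLowerSet := by
    rintro ⟨i, j⟩ ⟨i', j'⟩ ⟨hi, hj⟩ h
    simp only [Finset.coe_filter, Finset.mem_product, Finsupp.mem_support_iff, Finset.mem_range,
      Set.mem_ofPred_eq] at h hi hj ⊢
    have h0 := h.2 0 (by omega)
    have h1 := h.2 i' hi
    refine ⟨⟨by omega, by omega⟩, fun k hk => ?_⟩
    have := h.2 k (by omega)
    omega

theorem mem_diagram {l : ℕ →₀ ℕ} (hl : Antitone l) {i j : ℕ} :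
    (i, j) ∈ diagram l ↔ j < l i := by
  rw [← YoungDiagram.mem_cells]
  simp only [diagram, Finset.mem_filter, Finset.mem_product, Finsupp.mem_support_iff,
    Finset.mem_range]
  constructor
  · exact fun h => h.2 i le_rfl
  · intro h
    have := hl (Nat.zero_le i)
    refine ⟨⟨by omega, by omega⟩, fun k hk => ?_⟩
    have := hl hk
    omega

theorem card_diagram {l : ℕ →₀ ℕ} (hl : Antitone l) : (diagram l).card = l.degree := by
  have : (diagram l).cells = l.support.biUnion fun i =>
      (Finset.range (l i)).map (Function.Embedding.sectR i ℕ) := by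
    ext ⟨i, j⟩
    rw [YoungDiagram.mem_cells, mem_diagram hl]
    simp only [Finset.mem_biUnion, Finsupp.mem_support_iff, Finset.mem_map, Finset.mem_range,
      Function.Embedding.sectR_apply, Prod.mk.injEq]
    constructor
    · exact fun h => ⟨i, by omega, j, h, rfl, rfl⟩
    · rintro ⟨i', _, j', h, rfl, rfl⟩
      exact h
  rw [YoungDiagram.card, this, Finset.card_biUnion]
  · simp [Finsupp.degree_apply]
  · intro i _ i' _ hne
    refine Finset.disjoint_left.2 ?_
    rintro ⟨a, b⟩ h h'
    simp only [Finset.mem_map, Function.Embedding.sectR_apply, Prod.mk.injEq] at h h'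
    obtain ⟨_, _, rfl, _⟩ := h
    obtain ⟨_, _, rfl, _⟩ := h'
    exact hne rfl

theorem diagram_injOn {l k : ℕ →₀ ℕ} (hl : Antitone l) (hk : Antitone k)
    (h : diagram l = diagram k) : l = k := by
  ext i
  refine eq_of_forall_lt_iff fun j => ?_
  rw [← mem_diagram hl, ← mem_diagram hk, h]

/-- Tableaux with content `m` in the letters `0, …, N - 1`. -/
def tabSet (m : ℕ → ℕ) (N : ℕ) (l : YoungDiagram) : Set (SemistandardYoungTableau l) :=
  {T | (∀ c ∈ l.cells, T c.1 c.2 < N) ∧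
    ∀ i < N, (l.cells.filter fun c => T c.1 c.2 = i).card = m i}

/-- Filling the horizontal strip `l / k` with the letter `N`. -/
def extendTableau {l k : ℕ →₀ ℕ} (h : Interlace l k) (N : ℕ)
    (T : SemistandardYoungTableau (diagram k)) (hT : ∀ c ∈ (diagram k).cells, T c.1 c.2 < N) :
    SemistandardYoungTableau (diagram l) where
  entry i j := if j < k i then T i j else if j < l i then N else 0
  row_weak' := by
    intro i j1 j2 hj hc
    rw [mem_diagram h.antitone_left] at hc
    have hT' : ∀ i j, j < k i → T i j < N := fun i j hij =>
      hT (i, j) ((YoungDiagram.mem_cells _).2 ((mem_diagram h.antitone_right).2 hij))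
    by_cases h2 : j2 < k i
    · rw [if_pos h2, if_pos (hj.trans h2)]
      exact T.row_weak hj ((mem_diagram h.antitone_right).2 h2)
    · rw [if_neg h2, if_pos hc]
      split_ifs with h3 h4
      · exact (hT' _ _ h3).le
      · exact le_rfl
      · omega
  col_strict' := by
    intro i1 i2 j hi hc
    rw [mem_diagram h.antitone_left] at hc
    have hT' : ∀ i j, j < k i → T i j < N := fun i j hij =>
      hT (i, j) ((YoungDiagram.mem_cells _).2 ((mem_diagram h.antitone_right).2 hij))
    -- A horizontal strip has at most one cell per column: anything strictly above a cell of `l`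
    -- already lies in `k`.
    have h1 : j < k i1 := hc.trans_le ((h.antitone_left hi).trans (h i1).2)
    rw [if_pos h1]
    by_cases h2 : j < k i2
    · rw [if_pos h2]
      exact T.col_strict hi ((mem_diagram h.antitone_right).2 h2)
    · rw [if_neg h2, if_pos hc]
      exact hT' _ _ h1
  zeros' := by
    intro i j hc
    rw [mem_diagram h.antitone_left] at hc
    rw [if_neg hc, if_neg]
    exact fun h' => hc (h'.trans_le (h i).1)

theorem extendTableau_apply {l k : ℕ →₀ ℕ} (h : Interlace l k) (N : ℕ)
    (T : SemistandardYoungTableau (diagram k)) (hT : ∀ c ∈ (diagram k).cells, T c.1 c.2 < N)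
    (i j : ℕ) : extendTableau h N T hT i j =
      if j < k i then T i j else if j < l i then N else 0 := rfl

theorem extendTableau_mem {m : ℕ → ℕ} {l k : ℕ →₀ ℕ} (h : Interlace l k) {N : ℕ}
    (hd : l.degree = k.degree + m N)
    {T : SemistandardYoungTableau (diagram k)} (hT : T ∈ tabSet m N (diagram k)) :
    extendTableau h N T hT.1 ∈ tabSet m (N + 1) (diagram l) := by
  have hT' : ∀ i j, j < k i → T i j < N := fun i j hij =>
    hT.1 (i, j) ((YoungDiagram.mem_cells _).2 ((mem_diagram h.antitone_right).2 hij))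
  have hsub : (diagram k).cells ⊆ (diagram l).cells := by
    rintro ⟨i, j⟩ hc
    rw [YoungDiagram.mem_cells, mem_diagram h.antitone_right] at hc
    rw [YoungDiagram.mem_cells, mem_diagram h.antitone_left]
    exact hc.trans_le (h i).1
  constructor
  · rintro ⟨i, j⟩ -
    simp only [extendTableau_apply]
    split_ifs with h1
    · exact (hT' _ _ h1).trans (Nat.lt_succ_self N)
    · omega
    · omega
  · intro a ha
    rcases (Nat.lt_succ_iff_lt_or_eq.1 ha) with ha | rfl
    · rw [← hT.2 a ha]
      congr 1
      ext ⟨i, j⟩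
      rw [Finset.mem_filter, Finset.mem_filter]
      simp only [YoungDiagram.mem_cells, mem_diagram h.antitone_left,
        mem_diagram h.antitone_right, extendTableau_apply]
      constructor
      · rintro ⟨h1, h2⟩
        split_ifs at h2 with h3
        · exact ⟨h3, h2⟩
        · omega
      · rintro ⟨h1, h2⟩
        exact ⟨h1.trans_le (h i).1, by rw [if_pos h1, h2]⟩
    · have : ((diagram l).cells.filter fun c => extendTableau h a T hT.1 c.1 c.2 = a) =
          (diagram l).cells \ (diagram k).cells := by
        ext ⟨i, j⟩
        rw [Finset.mem_filter, Finset.mem_sdiff]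
        simp only [YoungDiagram.mem_cells,
          mem_diagram h.antitone_left, mem_diagram h.antitone_right, extendTableau_apply]
        refine and_congr_right fun h1 => ?_
        rw [if_pos h1]
        split_ifs with h2
        · have := hT' _ _ h2
          simp only [h2, not_true_eq_false, iff_false]
          omega
        · simp [h2]
      rw [this, Finset.card_sdiff_of_subset hsub]
      have h1 := card_diagram h.antitone_left
      have h2 := card_diagram h.antitone_right
      simp only [YoungDiagram.card] at h1 h2
      omega

/-- Filling the successive strips with `0, 1, …` turns a chain into a tableau, and the chain can be
read back from it. Only this injection is needed. -/
theorem chains_le_encard_tabSet (m : ℕ → ℕ) (N : ℕ) (l : ℕ →₀ ℕ) :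
    chains m N l ≤ ((tabSet m N (diagram l)).encard : ℝ≥0∞) := by
  induction N generalizing l with
  | zero =>
    simp only [chains]
    split_ifs with h
    · subst h
      rw [← ENat.toENNReal_one, ENat.toENNReal_le, Set.one_le_encard_iff_nonempty]
      refine ⟨SemistandardYoungTableau.highestWeight _, ?_, by simp⟩
      rintro ⟨i, j⟩ h
      rw [YoungDiagram.mem_cells, mem_diagram (fun _ _ _ => le_rfl)] at h
      simp at h
    · exact zero_le
  | succ N ih =>
    let S : Type := {k // Interlace l k ∧ l.degree = k.degree + m N}
    have e : chains m (N + 1) l = ∑' k : S, chains m N k.1 := by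
      refine Eq.trans ?_
        (tsum_subtype {k | Interlace l k ∧ l.degree = k.degree + m N} (chains m N)).symm
      refine tsum_congr fun k => ?_
      simp [Set.indicator_apply]
    have e' : ∑' k : S, ((tabSet m N (diagram k.1)).encard : ℝ≥0∞) =
        ∑' _ : (Σ k : S, tabSet m N (diagram k.1)), (1 : ℝ≥0∞) := by
      rw [ENNReal.tsum_sigma']
      exact tsum_congr fun k => (ENNReal.tsum_set_one _).symm
    have e'' : ∑' k : S, chains m N k.1 ≤ ∑' k : S, ((tabSet m N (diagram k.1)).encard : ℝ≥0∞) :=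
      ENNReal.tsum_le_tsum fun k : S => ih k.1
    rw [e]
    refine e''.trans ?_
    rw [e', ← ENNReal.tsum_set_one]
    let f : (Σ k : S, tabSet m N (diagram k.1)) → tabSet m (N + 1) (diagram l) := fun p =>
      ⟨extendTableau p.1.2.1 N p.2.1 p.2.2.1, extendTableau_mem p.1.2.1 p.1.2.2 p.2.2⟩
    refine ENNReal.tsum_comp_le_tsum_of_injective (f := f) ?_ (fun _ => (1 : ℝ≥0∞))
    rintro ⟨⟨k, hk⟩, ⟨T, hT⟩⟩ ⟨⟨k', hk'⟩, ⟨T', hT'⟩⟩ heq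
    have heq' : extendTableau hk.1 N T hT.1 = extendTableau hk'.1 N T' hT'.1 :=
      Subtype.mk.inj heq
    have hval : ∀ i j, extendTableau hk.1 N T hT.1 i j = extendTableau hk'.1 N T' hT'.1 i j :=
      fun i j => by rw [heq']
    -- The inner shape is recovered as the set of cells whose entry is less than `N`.
    have key : ∀ {k} (hk : Interlace l k ∧ l.degree = k.degree + m N)
        (T : SemistandardYoungTableau (diagram k)) (hT : T ∈ tabSet m N (diagram k)) (i j : ℕ),
        j < k i ↔ j < l i ∧ extendTableau hk.1 N T hT.1 i j < N := by
      intro k hk T hT i j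
      have h1 := (hk.1 i).1
      have h2 := hT.1 (i, j)
      rw [YoungDiagram.mem_cells, mem_diagram hk.1.antitone_right] at h2
      rw [extendTableau_apply]
      constructor
      · intro h
        rw [if_pos h]
        exact ⟨by omega, h2 h⟩
      · rintro ⟨h3, h4⟩
        by_contra hc
        simp [hc, h3] at h4
    have hkk : k = k' := by
      ext i
      refine eq_of_forall_lt_iff fun j => ?_
      rw [key hk T hT, key hk' T' hT', hval]
    subst hkk
    have hTT : T = T' := by
      ext i j
      have := hval i j
      simp only [extendTableau_apply] at this
      by_cases h : j < k i
      · simpa [h] using this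
      · have h' : (i, j) ∉ diagram k := fun h' => h ((mem_diagram hk.1.antitone_right).1 h')
        rw [T.zeros h', T'.zeros h']
    subst hTT
    rfl

/-! ### Kostka numbers and half of RSK -/

/-- The number of semistandard tableaux of shape `l` and content `m`. -/
def kostka (l : YoungDiagram) (m : ℕ → ℕ) : ℕ :=
  Set.ncard {T : SemistandardYoungTableau l |
    ∀ i, (l.cells.filter fun c => T c.1 c.2 = i).card = m i}

theorem finite_tableaux (l : YoungDiagram) (m : ℕ → ℕ) (N : ℕ) (hm : ∀ i, N ≤ i → m i = 0) :
    {T : SemistandardYoungTableau l |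
      ∀ i, (l.cells.filter fun c => T c.1 c.2 = i).card = m i}.Finite := by
  have key : ∀ T ∈ {T : SemistandardYoungTableau l |
      ∀ i, (l.cells.filter fun c => T c.1 c.2 = i).card = m i},
      ∀ c : l.cells, T c.1.1 c.1.2 < N := by
    intro T hT c
    by_contra h
    have h1 := hT (T c.1.1 c.1.2)
    rw [hm _ (by omega), Finset.card_eq_zero] at h1
    have : c.1 ∈ l.cells.filter fun d => T d.1 d.2 = T c.1.1 c.1.2 := by simp
    rw [h1] at this
    simp at this
  rw [← Set.finite_coe_iff]
  refine Finite.of_injective (fun T : {T : SemistandardYoungTableau l |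
      ∀ i, (l.cells.filter fun c => T c.1 c.2 = i).card = m i} =>
    fun c : l.cells => (⟨T.1 c.1.1 c.1.2, key T.1 T.2 c⟩ : Fin N)) ?_
  intro T T' h
  refine Subtype.ext (SemistandardYoungTableau.ext fun i j => ?_)
  by_cases hc : (i, j) ∈ l
  · have := congrFun h ⟨(i, j), (YoungDiagram.mem_cells _).2 hc⟩
    exact congrArg Fin.val this
  · rw [T.1.zeros hc, T'.1.zeros hc]

theorem encard_tabSet (l : YoungDiagram) (m : ℕ → ℕ) (N : ℕ) (hm : ∀ i, N ≤ i → m i = 0) :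
    (tabSet m N l).encard = (kostka l m : ℕ∞) := by
  rw [kostka, (finite_tableaux l m N hm).cast_ncard_eq]
  congr 1
  ext T
  simp only [tabSet, Set.mem_ofPred_eq]
  constructor
  · rintro ⟨h1, h2⟩ i
    rcases lt_or_ge i N with h | h
    · exact h2 i h
    · rw [hm i h, Finset.card_eq_zero, Finset.filter_eq_empty_iff]
      intro c hc hi
      have := h1 c hc
      omega
  · intro h
    refine ⟨fun c hc => ?_, fun i _ => h i⟩
    by_contra hN
    have h1 := h (T c.1 c.2)
    rw [hm _ (by omega), Finset.card_eq_zero, Finset.filter_eq_empty_iff] at h1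
    exact h1 hc rfl

/-- The content of standard tableaux of size `n`. -/
def stdContent (n : ℕ) : ℕ →₀ ℕ := ∑ i ∈ Finset.range n, single i 1

theorem stdContent_apply (n i : ℕ) : stdContent n i = if i < n then 1 else 0 := by
  simp [stdContent, Finsupp.finsetSum_apply, Finsupp.single_apply]

theorem chains_le_kostka (m : ℕ → ℕ) (N : ℕ) (hm : ∀ i, N ≤ i → m i = 0) (l : ℕ →₀ ℕ) :
    chains m N l ≤ kostka (diagram l) m := by
  have := chains_le_encard_tabSet m N l
  rwa [encard_tabSet _ _ _ hm, ENat.toENNReal_coe] at this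

/-- The insertion half of the RSK count: a word has at least enough pairs of tableaux to be matched
with. The reverse inequality comes from representation theory, through the sandwich. -/
theorem card_word_le_sum_kostka (n : ℕ) (m : ℕ →₀ ℕ) (hm : m.degree = n) :
    Nat.card (Word n m) ≤ ∑ l : Part n, kostka l.1 m * kostka l.1 (stdContent n) := by
  obtain ⟨N, hN⟩ : ∃ N, ∀ i, N ≤ i → m i = 0 := by
    refine ⟨m.support.sup id + 1, fun i hi => ?_⟩
    by_contra h
    have := Finset.le_sup (f := id) (Finsupp.mem_support_iff.2 h)
    simp at this
    omega
  have hdeg : m.degree = ∑ i ∈ Finset.range N, m i := by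
    rw [Finsupp.degree_apply]
    refine Finset.sum_subset ?_ fun i _ h => by simpa using h
    intro i hi
    rw [Finsupp.mem_support_iff] at hi
    by_contra hc
    exact hi (hN i (by simpa using hc))
  have h2 : ∀ l : ℕ →₀ ℕ, stdCount n l ≤ kostka (diagram l) (stdContent n) := by
    intro l
    refine (stdCount_le_chains n l).trans ?_
    rw [chains_congr (m' := stdContent n) fun i hi => by simp [stdContent_apply, hi]]
    exact chains_le_kostka _ _ (fun i hi => by simp [stdContent_apply, hi]) l
  have h3 : ∑' l, chains m N l * stdCount n l ≤
      ∑' l : Part n, ((kostka l.1 m * kostka l.1 (stdContent n) : ℕ) : ℝ≥0∞) := by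
    have e : ∑' l, chains m N l * stdCount n l =
        ∑' l : {l : ℕ →₀ ℕ // Antitone l ∧ l.degree = n}, chains m N l * stdCount n l := by
      refine (tsum_subtype_eq_of_support_subset
        (s := {l : ℕ →₀ ℕ | Antitone l ∧ l.degree = n}) ?_).symm
      intro l hl
      have : chains m N l ≠ 0 := left_ne_zero_of_mul hl
      exact ⟨antitone_of_chains_ne_zero this, by rw [degree_of_chains_ne_zero this, ← hdeg, hm]⟩
    rw [e]
    have h4 : ∀ l : {l : ℕ →₀ ℕ // Antitone l ∧ l.degree = n}, chains m N l * stdCount n l ≤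
        (fun l : Part n => ((kostka l.1 m * kostka l.1 (stdContent n) : ℕ) : ℝ≥0∞))
          ⟨diagram l.1, by rw [card_diagram l.2.1, l.2.2]⟩ := by
      intro l
      push_cast
      exact mul_le_mul' (chains_le_kostka _ _ hN _) (h2 _)
    refine (ENNReal.tsum_le_tsum h4).trans ?_
    refine ENNReal.tsum_comp_le_tsum_of_injective ?_ _
    intro a b h
    exact Subtype.ext (diagram_injOn a.2.1 b.2.1 (congrArg Subtype.val h))
  have h5 := (card_word_le n N m hN).trans h3
  rw [tsum_fintype] at h5
  exact_mod_cast h5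

end Positroid
end

noncomputable section

namespace Positroid

open Classical

/-! ### Young symmetrizers -/

section Stab

variable {n : ℕ}

/-- The permutations preserving a labelling `f` of the letters. -/
def stab (f : Fin n → ℕ) : Finset (SymGrp n) := Finset.univ.filter fun w => ∀ k, f (w k) = f k

theorem mem_stab {f : Fin n → ℕ} {w : SymGrp n} : w ∈ stab f ↔ ∀ k, f (w k) = f k := by
  simp [stab]

theorem one_mem_stab (f : Fin n → ℕ) : 1 ∈ stab f := mem_stab.2 fun _ => rfl

theorem mul_mem_stab {f : Fin n → ℕ} {v w : SymGrp n} (hv : v ∈ stab f) (hw : w ∈ stab f) :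
    v * w ∈ stab f :=
  mem_stab.2 fun k => by rw [Equiv.Perm.mul_apply, mem_stab.1 hv, mem_stab.1 hw]

theorem inv_mem_stab {f : Fin n → ℕ} {w : SymGrp n} (hw : w ∈ stab f) : w⁻¹ ∈ stab f :=
  mem_stab.2 fun k => by
    rw [← mem_stab.1 hw (w⁻¹ k)]
    simp

theorem swap_mem_stab {f : Fin n → ℕ} {i j : Fin n} (h : f i = f j) :
    Equiv.swap i j ∈ stab f := by
  refine mem_stab.2 fun k => ?_
  rcases eq_or_ne k i with rfl | hi
  · rw [Equiv.swap_apply_left, h]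
  rcases eq_or_ne k j with rfl | hj
  · rw [Equiv.swap_apply_right, h]
  rw [Equiv.swap_apply_of_ne_of_ne hi hj]

/-- The element of the group algebra attached to a permutation. -/
abbrev perm (w : SymGrp n) : GrpAlg n := MonoidAlgebra.of ℂ (SymGrp n) w

/-- The sign of a permutation as a complex number. -/
def sgn (w : SymGrp n) : ℂ := ((Equiv.Perm.sign w : ℤ) : ℂ)

theorem sgn_mul (v w : SymGrp n) : sgn (v * w) = sgn v * sgn w := by simp [sgn]

theorem sgn_one : sgn (1 : SymGrp n) = 1 := by simp [sgn]

theorem sgn_mul_self (v : SymGrp n) : sgn v * sgn v = 1 := by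
  rcases Int.units_eq_one_or (Equiv.Perm.sign v) with h | h <;> simp [sgn, h]

/-- The symmetrizer of the stabilizer of `f`. -/
def symm (f : Fin n → ℕ) : GrpAlg n := ∑ w ∈ stab f, perm w

/-- The antisymmetrizer of the stabilizer of `f`. -/
def alt (f : Fin n → ℕ) : GrpAlg n := ∑ w ∈ stab f, sgn w • perm w

theorem perm_mul_symm {f : Fin n → ℕ} {v : SymGrp n} (hv : v ∈ stab f) :
    perm v * symm f = symm f := by
  rw [symm, Finset.mul_sum]
  refine Finset.sum_nbij' (fun w => v * w) (fun w => v⁻¹ * w)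
    (fun w hw => mul_mem_stab hv hw) (fun w hw => mul_mem_stab (inv_mem_stab hv) hw)
    (fun w _ => by simp) (fun w _ => by simp) (fun w _ => by rw [perm, perm, perm, map_mul])

theorem alt_mul_perm {f : Fin n → ℕ} {v : SymGrp n} (hv : v ∈ stab f) :
    alt f * perm v = sgn v • alt f := by
  rw [alt, Finset.sum_mul, Finset.smul_sum]
  refine Finset.sum_nbij' (fun w => w * v) (fun w => w * v⁻¹)
    (fun w hw => mul_mem_stab hw hv) (fun w hw => mul_mem_stab hw (inv_mem_stab hv))
    (fun w _ => by simp) (fun w _ => by simp) (fun w _ => ?_)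
  rw [perm, perm, perm, map_mul, sgn_mul, smul_smul, smul_mul_assoc, mul_comm (sgn w),
    ← mul_assoc, sgn_mul_self, one_mul]

theorem alt_mul_alt (f : Fin n → ℕ) : alt f * alt f = ((stab f).card : ℂ) • alt f := by
  conv_lhs => rw [alt, ← alt]
  conv_lhs => arg 2; rw [alt]
  rw [Finset.mul_sum]
  have : ∀ w ∈ stab f, alt f * (sgn w • perm w) = alt f := fun w hw => by
    rw [mul_smul_comm, alt_mul_perm hw, smul_smul, sgn_mul_self, one_smul]
  rw [Finset.sum_congr rfl this, Finset.sum_const, Nat.cast_smul_eq_nsmul]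

/-- The transposition of `i` and `j` changes the sign of `alt c` from the right; carried past `g` it
becomes a transposition absorbed by `symm f`. The product therefore equals its own negative. -/
theorem alt_mul_perm_mul_symm_eq_zero {c f : Fin n → ℕ} {g : SymGrp n} {i j : Fin n} (hij : i ≠ j)
    (hc : c i = c j) (hf : f (g⁻¹ i) = f (g⁻¹ j)) : alt c * perm g * symm f = 0 := by
  have h1 := alt_mul_perm (swap_mem_stab hc)
  have h2 := perm_mul_symm (swap_mem_stab hf)
  have h3 : Equiv.swap i j * g = g * Equiv.swap (g⁻¹ i) (g⁻¹ j) := by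
    rw [Equiv.mul_swap_eq_swap_mul]
    simp
  have h4 : sgn (Equiv.swap i j) = -1 := by simp [sgn, Equiv.Perm.sign_swap hij]
  rw [h4, neg_one_smul] at h1
  have h5 : alt c * perm g * symm f = -(alt c * perm g * symm f) := by
    conv_lhs => rw [← h2, mul_assoc (alt c), ← mul_assoc (perm g), perm, perm, ← map_mul, ← h3,
      map_mul, mul_assoc, ← mul_assoc (alt c)]
    change alt c * perm _ * _ = _
    rw [h1, neg_mul, neg_inj, mul_assoc]
  have h6 : (2 : ℂ) • (alt c * perm g * symm f) = 0 := by
    rw [two_smul]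
    exact add_eq_zero_iff_eq_neg.2 h5
  exact (smul_eq_zero.1 h6).resolve_left two_ne_zero

end Stab

/-! ### Row and column symmetrizers of a diagram -/

section Cells

variable {n : ℕ} (l : Part n)

/-- The row of the cell numbered `k`. -/
def row (k : Fin n) : ℕ := (cellOf l k).1

/-- The column of the cell numbered `k`. -/
def col (k : Fin n) : ℕ := (cellOf l k).2

theorem cellOf_injective : Function.Injective (cellOf l) := fun _ _ h =>
  (Finset.orderEmbOfFin _ _).injective (ofLex.injective h)

theorem cellOf_mem (k : Fin n) : cellOf l k ∈ l.1.cells := by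
  have := Finset.orderEmbOfFin_mem (l.1.cells.map (toLex (α := ℕ × ℕ)).toEmbedding)
    ((Finset.card_map _).trans l.2) k
  rw [Finset.mem_map] at this
  obtain ⟨c, hc, h⟩ := this
  rw [cellOf, ← h]
  exact hc

theorem map_cellOf : Finset.univ.map ⟨cellOf l, cellOf_injective l⟩ = l.1.cells := by
  refine Finset.eq_of_subset_of_card_le ?_ ?_
  · intro c hc
    obtain ⟨k, -, rfl⟩ := Finset.mem_map.1 hc
    exact cellOf_mem l k
  · rw [Finset.card_map, Finset.card_univ, Fintype.card_fin]
    exact l.2.le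

theorem exists_cellOf {c : ℕ × ℕ} (hc : c ∈ l.1.cells) : ∃ k, cellOf l k = c := by
  rw [← map_cellOf, Finset.mem_map] at hc
  obtain ⟨k, -, h⟩ := hc
  exact ⟨k, h⟩

theorem card_filter_cells (p : ℕ × ℕ → Prop) :
    (l.1.cells.filter p).card = (Finset.univ.filter fun k => p (cellOf l k)).card := by
  rw [← map_cellOf, Finset.filter_map, Finset.card_map]
  rfl

theorem colLen_eq (j : ℕ) : l.1.colLen j = (Finset.univ.filter fun k => col l k = j).card := by
  rw [YoungDiagram.colLen_eq_card, YoungDiagram.col]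
  convert card_filter_cells l fun c => c.2 = j
  rfl

theorem rowLen_eq (i : ℕ) : l.1.rowLen i = (Finset.univ.filter fun k => row l k = i).card := by
  rw [YoungDiagram.rowLen_eq_card, YoungDiagram.row]
  convert card_filter_cells l fun c => c.1 = i
  rfl

theorem eq_of_row_comp {l l' : Part n} {g : SymGrp n} (h : ∀ k, row l' (g k) = row l k) :
    l = l' := by
  have : ∀ i, l.1.rowLen i = l'.1.rowLen i := by
    intro i
    rw [rowLen_eq, rowLen_eq]
    refine Finset.card_bij (fun k _ => g k) (fun k hk => ?_) (fun _ _ _ _ h => g.injective h)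
      (fun k hk => ⟨g⁻¹ k, ?_, by simp⟩)
    · simpa [h] using hk
    · simpa [← h] using hk
  refine Subtype.ext (YoungDiagram.ext ?_)
  ext ⟨i, j⟩
  rw [YoungDiagram.mem_cells, YoungDiagram.mem_cells, YoungDiagram.mem_iff_lt_rowLen,
    YoungDiagram.mem_iff_lt_rowLen, this]

/-- The statistic `n(λ) = ∑ i λ_i`. -/
def weight : ℕ := ∑ k, row l k

/-- A filling that is injective on columns dominates, column by column, the filling by row
indices. -/
theorem exists_row_comp_le (F : Fin n → ℕ) (hF : ∀ i j, col l i = col l j → F i = F j → i = j) :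
    ∃ u ∈ stab (col l), ∀ k, row l (u k) ≤ F k := by
  -- The size of `r k` is the rank of `F k` in its column, and `u` moves `k` to the row of that
  -- index. The rank is at most `F k` since the values in a column are distinct naturals.
  let r : Fin n → Finset (Fin n) := fun k =>
    Finset.univ.filter fun k' => col l k' = col l k ∧ F k' < F k
  have hr : ∀ k, (r k).card < l.1.colLen (col l k) := by
    intro k
    rw [colLen_eq]
    refine Finset.card_lt_card ⟨fun x hx => ?_, fun h => ?_⟩
    · simp only [r, Finset.mem_filter] at hx ⊢
      exact ⟨hx.1, hx.2.1⟩
    · have : k ∈ r k := h (by simp)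
      simp [r] at this
  have hex : ∀ k, ∃ k', cellOf l k' = ((r k).card, col l k) := fun k =>
    exists_cellOf l ((YoungDiagram.mem_cells _).2 (YoungDiagram.mem_iff_lt_colLen.2 (hr k)))
  choose u hu using hex
  have hlt : ∀ i j, col l i = col l j → F i < F j → (r i).card < (r j).card := by
    intro i j hc hij
    refine Finset.card_lt_card ⟨fun x hx => ?_, fun h => ?_⟩
    · simp only [r, Finset.mem_filter] at hx ⊢
      exact ⟨hx.1, hx.2.1.trans hc, hx.2.2.trans hij⟩
    · have : i ∈ r i := h (by simp [r, hc, hij])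
      simp [r] at this
  have hinj : Function.Injective u := by
    intro i j h
    have h1 := hu i
    rw [h, hu j, Prod.mk.injEq] at h1
    refine hF i j h1.2.symm ?_
    rcases lt_trichotomy (F i) (F j) with h2 | h2 | h2
    · have := hlt i j h1.2.symm h2
      omega
    · exact h2
    · have := hlt j i h1.2 h2
      omega
  refine ⟨Equiv.ofBijective u (Finite.injective_iff_bijective.1 hinj), ?_, ?_⟩
  · refine mem_stab.2 fun k => ?_
    rw [Equiv.ofBijective_apply, col, hu]
  · intro k
    rw [Equiv.ofBijective_apply, row, hu]
    change (r k).card ≤ F k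
    have : (r k).card ≤ (Finset.range (F k)).card := by
      refine Finset.card_le_card_of_injOn F (fun x hx => ?_) (fun x hx y hy h => ?_)
      · simp only [r, Finset.coe_filter, Set.mem_ofPred_eq] at hx
        simpa using hx.2.2
      · simp only [r, Finset.coe_filter, Set.mem_ofPred_eq] at hx hy
        exact hF x y (hx.2.1.trans hy.2.1.symm) h
    simpa using this

/-- Summing the cellwise bound gives the inequality, and equal sums force equality in every cell.
Thus the single number `weight` does the work of the dominance order. -/
theorem eq_row_comp_of_weight_le {F : Fin n → ℕ}
    (hF : ∀ i j, col l i = col l j → F i = F j → i = j) :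
    weight l ≤ ∑ k, F k ∧
      (∑ k, F k ≤ weight l → ∃ u ∈ stab (col l), ∀ k, row l (u k) = F k) := by
  obtain ⟨u, hu, h⟩ := exists_row_comp_le l F hF
  have e : weight l = ∑ k, row l (u k) := (Equiv.sum_comp u (row l)).symm
  refine ⟨e ▸ Finset.sum_le_sum fun k _ => h k, fun hle => ⟨u, hu, fun k => ?_⟩⟩
  have := (Finset.sum_eq_sum_iff_of_le (s := Finset.univ) fun k _ => h k).1
    (le_antisymm (Finset.sum_le_sum fun k _ => h k) (e ▸ hle))
  exact this k (Finset.mem_univ k)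

/-- If the product survives, no two letters of one column of `l` can come from one row of `l'`. The
row indices of `l'` moved by `g` are then a filling of `l` injective on columns. -/
theorem of_alt_mul_perm_mul_symm_ne_zero {l l' : Part n} {g : SymGrp n}
    (h : alt (col l) * perm g * symm (row l') ≠ 0) :
    weight l ≤ weight l' ∧ (weight l' ≤ weight l →
      ∃ u ∈ stab (col l), ∀ k, row l (u k) = row l' (g⁻¹ k)) := by
  have e : weight l' = ∑ k, row l' (g⁻¹ k) := (Equiv.sum_comp g⁻¹ (row l')).symm
  rw [e]
  refine eq_row_comp_of_weight_le l fun i j hc hf => ?_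
  by_contra hij
  exact h (alt_mul_perm_mul_symm_eq_zero hij hc hf)

theorem groupAlgebra_eq_sum (x : GrpAlg n) : x = ∑ g, x.coeff g • perm g := by
  refine MonoidAlgebra.ext (Finsupp.ext fun h => ?_)
  rw [MonoidAlgebra.coeff_sum, Finsupp.finsetSum_apply]
  simp [MonoidAlgebra.of_apply, Finsupp.single_apply]

theorem alt_mul_mul_symm_eq_zero {l l' : Part n} (hne : l ≠ l') (h : weight l' ≤ weight l)
    (x : GrpAlg n) : alt (col l) * x * symm (row l') = 0 := by
  rw [groupAlgebra_eq_sum x, Finset.mul_sum, Finset.sum_mul]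
  refine Finset.sum_eq_zero fun g _ => ?_
  rw [mul_smul_comm, smul_mul_assoc]
  by_contra hc
  have hc' := right_ne_zero_of_smul hc
  obtain ⟨u, hu, h'⟩ := (of_alt_mul_perm_mul_symm_ne_zero hc').2 h
  refine hne.symm (eq_of_row_comp (g := u * g) fun k => ?_)
  rw [Equiv.Perm.mul_apply, h']
  simp

theorem youngElt_eq : youngElt l = alt (col l) * symm (row l) := by
  rw [youngElt, alt, symm, Finset.sum_mul_sum, Finset.sum_comm]
  refine Finset.sum_congr (by ext; simp [mem_stab, col]) fun u _ =>
    Finset.sum_congr (by ext; simp [mem_stab, row]) fun w _ => ?_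
  rw [smul_mul_assoc, ← map_mul]
  rfl

/-- A surviving permutation factors as a column permutation times a row permutation, both absorbed
by the symmetrizers up to a sign. -/
theorem exists_alt_mul_mul_symm (x : GrpAlg n) :
    ∃ c : ℂ, alt (col l) * x * symm (row l) = c • youngElt l := by
  have key : ∀ g, ∃ c : ℂ, alt (col l) * perm g * symm (row l) = c • youngElt l := by
    intro g
    by_cases h : alt (col l) * perm g * symm (row l) = 0
    · exact ⟨0, by rw [h, zero_smul]⟩
    obtain ⟨u, hu, h'⟩ := (of_alt_mul_perm_mul_symm_ne_zero h).2 le_rfl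
    refine ⟨sgn u⁻¹, ?_⟩
    have hw : u * g ∈ stab (row l) := mem_stab.2 fun k => by
      rw [Equiv.Perm.mul_apply, h']
      simp
    have e : perm g = perm u⁻¹ * perm (u * g) := by
      rw [perm, perm, perm, ← map_mul]
      simp
    rw [e, mul_assoc, mul_assoc, perm_mul_symm hw, ← mul_assoc,
      alt_mul_perm (inv_mem_stab hu), youngElt_eq, smul_mul_assoc]
  choose c hc using key
  refine ⟨∑ g, x.coeff g * c g, ?_⟩
  conv_lhs => rw [groupAlgebra_eq_sum x]
  rw [Finset.mul_sum, Finset.sum_mul, Finset.sum_smul]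
  refine Finset.sum_congr rfl fun g _ => ?_
  rw [mul_smul_comm, smul_mul_assoc, hc, smul_smul]

theorem eq_one_of_mem_stab {u : SymGrp n} (h1 : u ∈ stab (row l)) (h2 : u ∈ stab (col l)) :
    u = 1 :=
  Equiv.ext fun k => cellOf_injective l (Prod.ext (mem_stab.1 h1 k) (mem_stab.1 h2 k))

/-- The identity arises as `u * w` only for `u = w = 1`, so its coefficient is one. -/
theorem youngElt_ne_zero : youngElt l ≠ 0 := by
  intro h
  have h1 : (youngElt l).coeff (1 : SymGrp n) = 1 := by
    rw [youngElt_eq, alt, symm, Finset.sum_mul_sum]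
    simp only [smul_mul_assoc, ← map_mul, perm]
    have : ∀ u ∈ stab (col l), ∀ w ∈ stab (row l),
        (sgn u • (MonoidAlgebra.of ℂ (SymGrp n)) (u * w)).coeff 1 =
          if u = 1 then (if w = 1 then 1 else 0) else (0 : ℂ) := by
      intro u hu w hw
      rw [MonoidAlgebra.coeff_smul_apply, MonoidAlgebra.of_apply,
        MonoidAlgebra.coeff_single, Finsupp.single_apply]
      by_cases huw : u * w = 1
      · have hu1 : u = 1 := by
          refine eq_one_of_mem_stab l ?_ hu
          rw [eq_inv_of_mul_eq_one_left huw]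
          exact inv_mem_stab hw
        subst hu1
        have hw1 : w = 1 := by simpa using huw
        simp [hw1, sgn_one]
      · rw [if_neg huw, smul_zero]
        split_ifs with h1 h2
        · exact absurd (by rw [h1, h2, one_mul]) huw
        · rfl
        · rfl
    simp only [MonoidAlgebra.coeff_sum, Finsupp.finsetSum_apply]
    rw [Finset.sum_congr rfl fun u hu => Finset.sum_congr rfl (this u hu)]
    simp [one_mem_stab]
  rw [h] at h1
  simp at h1

/-- A proper submodule is killed by `alt (col l)`, since otherwise it would contain a nonzero
multiple of the generator. Maschke's theorem then makes it zero, without computing the square of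
`youngElt l`. -/
instance isSimpleModule_specht : IsSimpleModule (GrpAlg n) (Specht l) := by
  rw [isSimpleModule_iff_isAtom]
  refine ⟨fun h => youngElt_ne_zero l (Submodule.span_singleton_eq_bot.1 h), fun U hU => ?_⟩
  have hmem : ∀ x ∈ U, ∃ y : GrpAlg n, x = y * youngElt l := fun x hx => by
    obtain ⟨y, hy⟩ := Submodule.mem_span_singleton.1 (hU.le hx)
    exact ⟨y, hy.symm⟩
  have key : ∀ x ∈ U, alt (col l) * x = 0 := by
    intro x hx
    by_contra hne
    obtain ⟨y, rfl⟩ := hmem x hx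
    obtain ⟨c, hc⟩ := exists_alt_mul_mul_symm l (y * alt (col l))
    have e : alt (col l) * (y * youngElt l) = c • youngElt l := by
      rw [← hc, youngElt_eq]
      simp only [mul_assoc]
    have hc0 : c ≠ 0 := by
      rintro rfl
      exact hne (by rw [e, zero_smul])
    have h1 : c • youngElt l ∈ U := e ▸ U.smul_mem (alt (col l)) hx
    have h2 : youngElt l ∈ U := by
      have := U.smul_mem (algebraMap ℂ (GrpAlg n) c⁻¹) h1
      rwa [algebraMap_smul, smul_smul, inv_mul_cancel₀ hc0, one_smul] at this
    exact hU.not_ge (Submodule.span_le.2 (by simpa using h2))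
  -- A projection of the regular module is right multiplication by `p 1`. Hence `x = y * alt * (symm
  -- * p 1)` for `x` in `U`, and the bracket lies in `U`, where `alt` acts by zero.
  obtain ⟨W, hW⟩ := exists_isCompl U
  let p := U.projection W hW
  have hp : ∀ x, p x = x * p 1 := fun x => by
    rw [← smul_eq_mul x (p 1), ← map_smul, smul_eq_mul, mul_one]
  have h1 : p 1 ∈ U := Submodule.projection_apply_mem hW 1
  have hpU : ∀ x ∈ U, x = x * p 1 := fun x hx => by
    rw [← hp]
    exact (Submodule.projection_apply_left hW ⟨x, hx⟩).symm
  rw [eq_bot_iff]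
  intro x hx
  obtain ⟨y, hy⟩ := hmem x hx
  have h2 : symm (row l) * p 1 ∈ U := U.smul_mem (symm (row l)) h1
  have h3 := hpU x hx
  rw [hy, youngElt_eq, mul_assoc, mul_assoc, key _ h2, mul_zero] at h3
  rw [Submodule.mem_bot, hy, youngElt_eq, h3]

theorem alt_smul_specht_eq_zero {l l' : Part n} (hne : l ≠ l') (h : weight l' ≤ weight l)
    (x : Specht l') : alt (col l) • x = 0 := by
  obtain ⟨y, hy⟩ := Submodule.mem_span_singleton.1 x.2
  refine Subtype.ext ?_
  change alt (col l) * x.1 = 0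
  rw [← hy, smul_eq_mul, youngElt_eq, ← mul_assoc, ← mul_assoc, mul_assoc (alt (col l)),
    alt_mul_mul_symm_eq_zero hne h]

/-- For distinct shapes, the column antisymmetrizer of the shape of larger or equal weight kills the
other Specht module, but not its own, because `alt` is idempotent up to a nonzero scalar. -/
theorem eq_of_specht_equiv {l l' : Part n} (e : Specht l ≃ₗ[GrpAlg n] Specht l') : l = l' := by
  have key : ∀ {l l' : Part n}, (Specht l ≃ₗ[GrpAlg n] Specht l') → weight l' ≤ weight l →
      l = l' := by
    intro l l' e h
    by_contra hne
    have h1 := alt_smul_specht_eq_zero hne h (e ⟨youngElt l, Submodule.mem_span_singleton_self _⟩)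
    rw [← map_smul, e.map_eq_zero_iff] at h1
    have h2 : alt (col l) * youngElt l = 0 := congrArg Subtype.val h1
    rw [youngElt_eq, ← mul_assoc, alt_mul_alt, smul_mul_assoc, ← youngElt_eq, smul_eq_zero] at h2
    rcases h2 with h2 | h2
    · have := Finset.card_pos.2 ⟨1, one_mem_stab (col l)⟩
      rw [Nat.cast_eq_zero] at h2
      omega
    · exact youngElt_ne_zero l h2
  rcases le_total (weight l') (weight l) with h | h
  · exact key e h
  · exact (key e.symm h).symm

end Cells

end Positroid
end

noncomputable section

namespace Positroid

open Classical

/-! ### Invariants of Young subgroups and semistandard tableaux -/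

section Invariants

variable {n : ℕ}

/-- The invariants of the stabilizer of the labelling `f`. -/
def invariantsOf (f : Fin n → ℕ) (N : Type*) [AddCommGroup N] [Module ℂ N] [Module (GrpAlg n) N]
    [IsScalarTower ℂ (GrpAlg n) N] : Submodule ℂ N where
  carrier := {x | ∀ w ∈ stab f, perm w • x = x}
  zero_mem' := fun w _ => smul_zero _
  add_mem' := fun {x y} hx hy w hw => by rw [smul_add, hx w hw, hy w hw]
  smul_mem' := fun c x hx w hw => by rw [smul_comm, hx w hw]

theorem mem_invariantsOf {f : Fin n → ℕ} {N : Type*} [AddCommGroup N] [Module ℂ N]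
    [Module (GrpAlg n) N] [IsScalarTower ℂ (GrpAlg n) N] {x : N} :
    x ∈ invariantsOf f N ↔ ∀ w ∈ stab f, perm w • x = x := Iff.rfl

instance finite_groupAlgebra : Module.Finite ℂ (GrpAlg n) :=
  Module.Finite.equiv (MonoidAlgebra.coeffLinearEquiv ℂ : GrpAlg n ≃ₗ[ℂ] (SymGrp n →₀ ℂ)).symm

instance finite_specht (l : Part n) : Module.Finite ℂ (Specht l) :=
  Module.Finite.of_injective ((Specht l).subtype.restrictScalars ℂ) (Specht l).injective_subtype

/-- Two labellings with the same content differ by a permutation. -/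
theorem exists_equiv_comp {α β γ : Type*} [Fintype α] [Fintype β] [DecidableEq γ]
    (f : α → γ) (g : β → γ)
    (h : ∀ i, (Finset.univ.filter fun a => f a = i).card =
      (Finset.univ.filter fun b => g b = i).card) : ∃ e : α ≃ β, ∀ a, g (e a) = f a := by
  have key : ∀ i, Nonempty ({a // f a = i} ≃ {b // g b = i}) := fun i =>
    Fintype.card_eq.1 (by rw [Fintype.card_subtype, Fintype.card_subtype, h])
  let E := fun i => (key i).some
  refine ⟨(Equiv.sigmaFiberEquiv f).symm.trans
    ((Equiv.sigmaCongrRight E).trans (Equiv.sigmaFiberEquiv g)), fun a => ?_⟩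
  exact (E (f a) ⟨a, rfl⟩).2

/-- In a vanishing combination, the functional attached to a term of maximal `φ` with nonzero
coefficient sees only that term. -/
theorem linearIndependent_of_triangular {ι V : Type*} [AddCommGroup V] [Module ℂ V]
    (x : ι → V) (ev : ι → V →ₗ[ℂ] ℂ) (φ : ι → ℕ) (hdiag : ∀ i, ev i (x i) ≠ 0)
    (htri : ∀ i j, i ≠ j → ev i (x j) ≠ 0 → φ i < φ j) : LinearIndependent ℂ x := by
  rw [linearIndependent_iff']
  intro s c hsum
  by_contra! hc
  have hne : (s.filter fun i => c i ≠ 0).Nonempty := by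
    obtain ⟨i, hi, h⟩ := hc
    exact ⟨i, Finset.mem_filter.2 ⟨hi, h⟩⟩
  obtain ⟨i, hi, hmax⟩ := Finset.exists_max_image _ φ hne
  rw [Finset.mem_filter] at hi
  have h1 := congrArg (ev i) hsum
  rw [map_sum, map_zero, Finset.sum_eq_single_of_mem i hi.1] at h1
  · rw [map_smul, smul_eq_mul] at h1
    exact mul_ne_zero hi.2 (hdiag i) h1
  · intro j hj hji
    rw [map_smul, smul_eq_mul]
    by_contra hne
    have h2 := htri i j hji.symm (right_ne_zero_of_mul hne)
    have h3 := hmax j (Finset.mem_filter.2 ⟨hj, left_ne_zero_of_mul hne⟩)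
    omega

/-- The equality case of the rearrangement inequality gives `∑ R (u i) * R i = ∑ R i ^ 2`, so the
sum of squares of `R (u i) - R i` vanishes. -/
theorem eq_one_of_monovary {R : Fin n → ℤ} (hR : Function.Injective R) {u : SymGrp n}
    (h : Monovary (R ∘ u) R) : u = 1 := by
  have h1 := ((monovary_self R).sum_comp_perm_smul_eq_sum_smul_iff (σ := u)).2 h
  have h2 : ∑ i, R (u i) ^ 2 = ∑ i, R i ^ 2 := Equiv.sum_comp u fun i => R i ^ 2
  have h3 : ∑ i, (R (u i) - R i) ^ 2 = 0 := by
    simp only [smul_eq_mul] at h1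
    have : ∀ i, (R (u i) - R i) ^ 2 = R (u i) ^ 2 + R i ^ 2 - 2 * (R (u i) * R i) :=
      fun i => by ring
    simp only [this, Finset.sum_sub_distrib, Finset.sum_add_distrib, ← Finset.mul_sum, h1, h2]
    simp only [pow_two]
    ring
  rw [Finset.sum_eq_zero_iff_of_nonneg fun i _ => sq_nonneg _] at h3
  refine Equiv.ext fun i => hR ?_
  have := h3 i (Finset.mem_univ i)
  rw [sq_eq_zero_iff, sub_eq_zero] at this
  exact this

/-- The rearrangement inequality for fillings increasing along columns. -/
theorem sum_comp_mul_le {r c F : Fin n → ℕ} (hinj : ∀ i j, r i = r j → c i = c j → i = j)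
    (hF : ∀ i j, c i = c j → r i < r j → F i < F j) {u : SymGrp n} (hu : u ∈ stab c) :
    ∑ k, F (u k) * r k ≤ ∑ k, F k * r k ∧
      (∑ k, F k * r k ≤ ∑ k, F (u k) * r k → u = 1) := by
  -- `M` and `N` exceed all values of `F` and `r`, so `F'` and `R` compare columns first. This turns
  -- the columnwise problem into one rearrangement over all cells.
  set M : ℕ := ∑ k, F k + 1
  set N : ℕ := ∑ k, r k + 1
  let F' : Fin n → ℤ := fun k => F k + M * c k
  let R : Fin n → ℤ := fun k => r k + N * c k
  have hM : ∀ k, F k < M := fun k =>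
    Nat.lt_succ_of_le (Finset.single_le_sum (f := F) (fun _ _ => Nat.zero_le _) (Finset.mem_univ k))
  have hN : ∀ k, r k < N := fun k =>
    Nat.lt_succ_of_le (Finset.single_le_sum (f := r) (fun _ _ => Nat.zero_le _) (Finset.mem_univ k))
  have hlt : ∀ {K : ℕ} {a b x y : ℕ}, a < K → x < y → (a + K * x : ℤ) < b + K * y := by
    intro K a b x y ha hxy
    have : a + K * x < b + K * y := by nlinarith
    exact_mod_cast this
  have hRc : ∀ i j, R i < R j → c i < c j ∨ (c i = c j ∧ r i < r j) := by
    intro i j h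
    rcases lt_trichotomy (c i) (c j) with hc | hc | hc
    · exact Or.inl hc
    · refine Or.inr ⟨hc, ?_⟩
      simp only [R, hc] at h
      exact_mod_cast (add_lt_add_iff_right _).1 h
    · exact absurd h (not_lt.2 (hlt (hN j) hc).le)
  have hRF : ∀ i j, R i < R j → F' i < F' j := by
    intro i j h
    rcases hRc i j h with hc | ⟨hc, hr⟩
    · exact hlt (hM i) hc
    · simp only [F', hc]
      have := hF i j hc hr
      gcongr
  have hRinj : Function.Injective R := by
    intro i j h
    rcases lt_trichotomy (c i) (c j) with hc | hc | hc
    · exact absurd h (hlt (hN i) hc).ne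
    · refine hinj i j ?_ hc
      simp only [R, hc] at h
      exact_mod_cast add_right_cancel h
    · exact absurd h (hlt (hN j) hc).ne'
  have hmono : Monovary F' R := fun i j h => (hRF i j h).le
  -- The cross terms do not depend on `v`, because `v` preserves columns; only the sum to be
  -- compared varies.
  have e : ∀ v ∈ stab c, ∑ k, F' (v k) • R k = ((∑ k, F (v k) * r k : ℕ) : ℤ) +
      (N * ∑ k, (F k : ℤ) * c k + M * ∑ k, (c k : ℤ) * R k) := by
    intro v hv
    have h1 : ∑ k, (F k : ℤ) * c k = ∑ k, (F (v k) : ℤ) * c k := by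
      rw [← Equiv.sum_comp v]
      exact Finset.sum_congr rfl fun k _ => by rw [mem_stab.1 hv]
    rw [h1]
    push_cast
    simp only [Finset.mul_sum, ← Finset.sum_add_distrib]
    refine Finset.sum_congr rfl fun k _ => ?_
    simp only [F', R, mem_stab.1 hv, smul_eq_mul]
    ring
  have e1 := e u hu
  have e2 := e 1 (one_mem_stab c)
  simp only [Equiv.Perm.one_apply] at e2
  have h1 := hmono.sum_comp_perm_smul_le_sum_smul (σ := u)
  rw [e1, e2] at h1
  have h2 : ∑ k, F (u k) * r k ≤ ∑ k, F k * r k := by exact_mod_cast (add_le_add_iff_right _).1 h1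
  refine ⟨h2, fun h3 => eq_one_of_monovary hRinj fun i j h => ?_⟩
  have h4 : Monovary (F' ∘ u) R :=
    hmono.sum_comp_perm_smul_eq_sum_smul_iff.1 (by rw [e1, e2, le_antisymm h2 h3])
  by_contra hc
  exact absurd (hRF _ _ (not_le.1 hc)) (not_lt.2 (h4 h))

/-! ### Independent invariants indexed by semistandard tableaux -/

variable (l : Part n)

/-- The entries of a tableau in row-reading order. -/
def entries (T : SemistandardYoungTableau l.1) (k : Fin n) : ℕ := T (row l k) (col l k)

theorem entries_injective {T T' : SemistandardYoungTableau l.1} (h : entries l T = entries l T') :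
    T = T' := by
  ext i j
  by_cases hc : (i, j) ∈ l.1
  · obtain ⟨k, hk⟩ := exists_cellOf l ((YoungDiagram.mem_cells _).2 hc)
    have := congrFun h k
    simpa [entries, row, col, hk] using this
  · rw [T.zeros hc, T'.zeros hc]

theorem entries_lt {T : SemistandardYoungTableau l.1} {i j : Fin n} (hc : col l i = col l j)
    (hr : row l i < row l j) : entries l T i < entries l T j := by
  rw [entries, entries, hc]
  exact T.col_strict hr ((YoungDiagram.mem_cells _).1 (cellOf_mem l j))

theorem cellOf_strictMono : StrictMono fun k => toLex (cellOf l k) :=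
  (Finset.orderEmbOfFin _ ((Finset.card_map _).trans l.2)).strictMono

theorem monotone_row_entries (T : SemistandardYoungTableau l.1) :
    Monotone fun k => toLex (row l k, entries l T k) := by
  intro i j hij
  rcases hij.eq_or_lt with rfl | hij
  · exact le_rfl
  have h := cellOf_strictMono l hij
  rw [Prod.Lex.toLex_lt_toLex] at h
  rw [Prod.Lex.toLex_le_toLex]
  rcases h with h | ⟨h1, h2⟩
  · exact Or.inl h
  · refine Or.inr ⟨h1, ?_⟩
    change T (row l i) (col l i) ≤ T (row l j) (col l j)
    rw [show row l i = row l j from h1]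
    exact T.row_weak h2 ((YoungDiagram.mem_cells _).1 (cellOf_mem l j))

/-- Read by rows, both tableaux are increasing rearrangements of the same list of pairs (row,
entry), and a sorted rearrangement is unique. -/
theorem entries_comp_row {T T' : SemistandardYoungTableau l.1} {w : SymGrp n}
    (hw : w ∈ stab (row l)) (h : ∀ k, entries l T' k = entries l T (w k)) : T' = T := by
  refine entries_injective l ?_
  have h1 : Monotone ((fun k => toLex (row l k, entries l T k)) ∘ (1 : SymGrp n)) :=
    monotone_row_entries l T
  have h2 : Monotone ((fun k => toLex (row l k, entries l T k)) ∘ w) := by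
    convert monotone_row_entries l T' using 1
    ext k : 1
    simp only [Function.comp_apply, mem_stab.1 hw, h]
  have h3 := Tuple.unique_monotone h1 h2
  ext k
  have h4 := congrArg (fun p => (ofLex p).2) (congrFun h3 k)
  rw [h]
  exact h4.symm

/-- The statistic ordering the tableaux of a given shape. -/
def energy (F : Fin n → ℕ) : ℕ := ∑ k, F k * row l k

theorem energy_comp (F : Fin n → ℕ) {w : SymGrp n} (hw : w ∈ stab (row l)) :
    energy l (fun k => F (w k)) = energy l F := by
  refine Eq.trans (Finset.sum_congr rfl fun k _ => ?_) (Equiv.sum_comp w fun k => F k * row l k)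
  rw [mem_stab.1 hw]

theorem energy_entries_comp (T : SemistandardYoungTableau l.1) {u w : SymGrp n}
    (hu : u ∈ stab (col l)) (hw : w ∈ stab (row l)) :
    energy l (fun k => entries l T (u (w k))) ≤ energy l (entries l T) ∧
      (energy l (entries l T) ≤ energy l (fun k => entries l T (u (w k))) → u = 1) := by
  rw [energy_comp l (fun k => entries l T (u k)) hw]
  exact sum_comp_mul_le (fun i j h1 h2 => cellOf_injective l (Prod.ext h1 h2))
    (fun i j h1 h2 => entries_lt l h1 h2) hu

/-- The coefficient of a permutation, as a linear form. -/
def coeffAt (h : SymGrp n) : GrpAlg n →ₗ[ℂ] ℂ where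
  toFun x := x.coeff h
  map_add' _ _ := rfl
  map_smul' _ _ := rfl

theorem coeffAt_perm (h g : SymGrp n) : coeffAt h (perm g) = if g = h then 1 else 0 := by
  change (MonoidAlgebra.single g (1 : ℂ)).coeff h = _
  rw [MonoidAlgebra.coeff_single, Finsupp.single_apply]

/-- The sum of the permutations carrying the labelling `f` to `F`. -/
def carrySum (f F : Fin n → ℕ) : GrpAlg n :=
  ∑ g : SymGrp n with (∀ k, f (g k) = F k), perm g

theorem perm_mul_carrySum {f : Fin n → ℕ} (F : Fin n → ℕ) {v : SymGrp n} (hv : v ∈ stab f) :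
    perm v * carrySum f F = carrySum f F := by
  rw [carrySum, Finset.mul_sum]
  refine Finset.sum_nbij' (fun w => v * w) (fun w => v⁻¹ * w) (fun w hw => ?_) (fun w hw => ?_)
    (fun w _ => by simp) (fun w _ => by simp) (fun w _ => by rw [perm, perm, perm, map_mul])
  · simp only [Finset.mem_filter, Finset.mem_univ, true_and] at hw ⊢
    intro k
    rw [Equiv.Perm.mul_apply, mem_stab.1 hv, hw]
  · simp only [Finset.mem_filter, Finset.mem_univ, true_and] at hw ⊢
    intro k
    rw [Equiv.Perm.mul_apply, mem_stab.1 (inv_mem_stab hv), hw]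

theorem coeffAt_carrySum_mul (f F : Fin n → ℕ) (h : SymGrp n) :
    coeffAt h (carrySum f F * youngElt l) =
      ∑ g : SymGrp n with (∀ k, f (g k) = F k), ∑ u ∈ stab (col l), ∑ w ∈ stab (row l),
        if g * (u * w) = h then sgn u else 0 := by
  rw [youngElt_eq, carrySum, alt, symm, Finset.sum_mul_sum, Finset.sum_mul, map_sum]
  refine Finset.sum_congr rfl fun g _ => ?_
  rw [Finset.mul_sum, map_sum]
  refine Finset.sum_congr rfl fun u _ => ?_
  rw [Finset.mul_sum, map_sum]
  refine Finset.sum_congr rfl fun w _ => ?_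
  rw [smul_mul_assoc, mul_smul_comm, map_smul, perm, perm, perm, ← map_mul, ← map_mul,
    coeffAt_perm]
  simp

/-- A contributing factorization satisfies `T ∘ u ∘ w = T`. Equality of energies then forces `u =
1`, so all contributions have sign `+` and none cancel; `g = h`, `u = w = 1` is one of them. -/
theorem coeffAt_carrySum_mul_self {f : Fin n → ℕ} (T : SemistandardYoungTableau l.1)
    {h : SymGrp n} (hh : ∀ k, f (h k) = entries l T k) :
    coeffAt h (carrySum f (entries l T) * youngElt l) ≠ 0 := by
  rw [coeffAt_carrySum_mul]
  have key : (∑ g : SymGrp n with (∀ k, f (g k) = entries l T k), ∑ u ∈ stab (col l),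
      ∑ w ∈ stab (row l), if g * (u * w) = h then sgn u else 0) =
      ((∑ g : SymGrp n with (∀ k, f (g k) = entries l T k), ∑ u ∈ stab (col l),
        ∑ w ∈ stab (row l), if g * (u * w) = h then 1 else 0 : ℕ) : ℂ) := by
    push_cast
    refine Finset.sum_congr rfl fun g hg => Finset.sum_congr rfl fun u hu =>
      Finset.sum_congr rfl fun w hw => ?_
    split_ifs with hguw
    · simp only [Finset.mem_filter, Finset.mem_univ, true_and] at hg
      have e : (fun k => entries l T (u (w k))) = entries l T := by
        ext k
        rw [← hg, ← hh, ← hguw]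
        rfl
      rw [(energy_entries_comp l T hu hw).2 (by rw [e]), sgn_one]
    · rfl
  rw [key, Nat.cast_ne_zero]
  refine ne_of_gt (Finset.sum_pos' (fun _ _ => Nat.zero_le _) ⟨h, by simpa using hh, ?_⟩)
  refine Finset.sum_pos' (fun _ _ => Nat.zero_le _) ⟨1, one_mem_stab _, ?_⟩
  refine Finset.sum_pos' (fun _ _ => Nat.zero_le _) ⟨1, one_mem_stab _, ?_⟩
  simp

/-- A contribution gives `T' = T ∘ u ∘ w`, which cannot raise the energy. If the energy is unchanged
then `u = 1`, and a row rearrangement of `T` that is again a tableau is `T`. -/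
theorem energy_lt_of_coeffAt_ne_zero {f : Fin n → ℕ} {T T' : SemistandardYoungTableau l.1}
    {h : SymGrp n} (hh : ∀ k, f (h k) = entries l T' k) (hne : T' ≠ T)
    (hc : coeffAt h (carrySum f (entries l T) * youngElt l) ≠ 0) :
    energy l (entries l T') < energy l (entries l T) := by
  rw [coeffAt_carrySum_mul] at hc
  obtain ⟨g, hg, hc⟩ := Finset.exists_ne_zero_of_sum_ne_zero hc
  obtain ⟨u, hu, hc⟩ := Finset.exists_ne_zero_of_sum_ne_zero hc
  obtain ⟨w, hw, hc⟩ := Finset.exists_ne_zero_of_sum_ne_zero hc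
  have hguw : g * (u * w) = h := by
    by_contra hguw
    rw [if_neg hguw] at hc
    exact hc rfl
  simp only [Finset.mem_filter, Finset.mem_univ, true_and] at hg
  have e : entries l T' = fun k => entries l T (u (w k)) := by
    ext k
    rw [← hg, ← hh, ← hguw]
    rfl
  have h1 := energy_entries_comp l T hu hw
  rw [← e] at h1
  refine lt_of_le_of_ne h1.1 fun h2 => hne ?_
  have h3 := h1.2 h2.ge
  refine entries_comp_row l hw fun k => ?_
  rw [e, h3]
  rfl

theorem kostka_le_finrank {f : Fin n → ℕ} {m : ℕ → ℕ}
    (hf : ∀ i, (Finset.univ.filter fun k => f k = i).card = m i) :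
    kostka l.1 m ≤ Module.finrank ℂ (invariantsOf f (Specht l)) := by
  let 𝒯 := {T : SemistandardYoungTableau l.1 |
    ∀ i, (l.1.cells.filter fun c => T c.1 c.2 = i).card = m i}
  have hfin : 𝒯.Finite := by
    refine finite_tableaux l.1 m (Finset.univ.sup f + 1) fun i hi => ?_
    rw [← hf, Finset.card_eq_zero, Finset.filter_eq_empty_iff]
    intro k _ hk
    have := Finset.le_sup (f := f) (Finset.mem_univ k)
    omega
  have : Fintype 𝒯 := hfin.fintype
  have hcarry : ∀ T : 𝒯, ∃ g : SymGrp n, ∀ k, f (g k) = entries l T.1 k := by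
    intro T
    refine exists_equiv_comp _ _ fun i => ?_
    rw [hf, ← T.2]
    convert (card_filter_cells l fun c => T.1 c.1 c.2 = i).symm
    rfl
  choose g hg using hcarry
  let x : 𝒯 → invariantsOf f (Specht l) := fun T =>
    ⟨⟨carrySum f (entries l T.1) * youngElt l, Submodule.mem_span_singleton.2 ⟨_, rfl⟩⟩,
      fun w hw => Subtype.ext (by
        change perm w * (carrySum f (entries l T.1) * youngElt l) = _
        rw [← mul_assoc, perm_mul_carrySum _ hw])⟩
  let ev : 𝒯 → invariantsOf f (Specht l) →ₗ[ℂ] ℂ := fun T =>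
    coeffAt (g T) ∘ₗ (Specht l).subtype.restrictScalars ℂ ∘ₗ (invariantsOf f (Specht l)).subtype
  have hx : LinearIndependent ℂ x := by
    refine linearIndependent_of_triangular x ev (fun T => energy l (entries l T.1)) ?_ ?_
    · exact fun T => coeffAt_carrySum_mul_self l T.1 (hg T)
    · exact fun T T' hne h =>
        energy_lt_of_coeffAt_ne_zero l (hg T) (fun h' => hne (Subtype.ext h')) h
  have h1 := hx.fintype_card_le_finrank
  have h2 : kostka l.1 m = Fintype.card 𝒯 := by
    rw [← Nat.card_eq_fintype_card]
    rfl
  rw [h2]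
  exact h1

end Invariants

end Positroid
end

noncomputable section

namespace Positroid

open Classical

/-! ### Completeness of the Specht modules -/

section Density

variable {n : ℕ}

theorem exists_smul_of_simple_endo (l : Part n) (φ : Specht l →ₗ[GrpAlg n] Specht l) :
    ∃ c : ℂ, ∀ x, φ x = c • x := by
  obtain ⟨c, hc⟩ := (IsSimpleModule.algebraMap_end_bijective_of_isAlgClosed ℂ
    (A := GrpAlg n) (V := Specht l)).2 φ
  exact ⟨c, fun x => by rw [← hc]; rfl⟩

theorem hom_specht_eq_zero {l l' : Part n} (hne : l ≠ l') (φ : Specht l →ₗ[GrpAlg n] Specht l') :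
    φ = 0 := by
  by_contra h
  exact hne (eq_of_specht_equiv (LinearEquiv.ofBijective φ (LinearMap.bijective_of_ne_zero h)))

/-- The group algebra acts on the Specht modules by arbitrary tuples of linear maps. -/
theorem exists_smul_eq (T : (l : Part n) → Specht l →ₗ[ℂ] Specht l) :
    ∃ r : GrpAlg n, ∀ l x, r • x = T l x := by
  let M := (l : Part n) → Specht l
  have hcomp : ∀ φ : Module.End (GrpAlg n) M, ∀ l : Part n, ∃ c : ℂ, ∀ v : M, φ v l = c • v l := by
    intro φ l
    obtain ⟨c, hc⟩ := exists_smul_of_simple_endo l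
      (LinearMap.proj l ∘ₗ φ ∘ₗ LinearMap.single (GrpAlg n) (fun l : Part n => Specht l) l)
    refine ⟨c, fun v => ?_⟩
    have h1 : v = ∑ l', LinearMap.single (GrpAlg n) (fun l : Part n => Specht l) l' (v l') := by
      ext l' : 1
      simp [Finset.sum_apply]
    conv_lhs => rw [h1]
    rw [map_sum, Finset.sum_apply, Finset.sum_eq_single l]
    · exact hc (v l)
    · intro l' _ hne
      exact LinearMap.congr_fun (hom_specht_eq_zero hne
        (LinearMap.proj l ∘ₗ φ ∘ₗ LinearMap.single (GrpAlg n) (fun l : Part n => Specht l) l'))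
        (v l')
    · simp
  -- By Schur's lemma the endomorphisms of the sum act by a scalar on each summand, so every tuple
  -- `T` commutes with them; density then realizes it by a group algebra element.
  let F : Module.End (Module.End (GrpAlg n) M) M :=
    { toFun := fun v l => T l (v l)
      map_add' := fun v v' => funext fun l => (T l).map_add (v l) (v' l)
      map_smul' := fun φ v => by
        ext l : 1
        obtain ⟨c, hc⟩ := hcomp φ l
        change T l (φ v l) = φ (fun l => T l (v l)) l
        rw [hc, hc, map_smul] }
  have : Module.Finite (Module.End (GrpAlg n) M) M :=
    Module.Finite.of_restrictScalars_finite ℂ _ _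
  obtain ⟨r, hr⟩ := Module.Finite.toModuleEnd_moduleEnd_surjective (R := GrpAlg n) (M := M) F
  refine ⟨r, fun l x => ?_⟩
  have : r • (Pi.single l x : M) l = T l ((Pi.single l x : M) l) :=
    congrFun (LinearMap.congr_fun hr (Pi.single l x)) l
  rwa [Pi.single_eq_same] at this

/-! ### The sandwich proving Young's rule -/

/-- The action of the invariants in the group algebra on the Specht modules. -/
def invariantsAction (f : Fin n → ℕ) : invariantsOf f (GrpAlg n) →ₗ[ℂ]
    ((l : Part n) → Specht l →ₗ[ℂ] invariantsOf f (Specht l)) where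
  toFun x l :=
    { toFun := fun s => ⟨x.1 • s, fun w hw => by rw [smul_smul, ← smul_eq_mul, x.2 w hw]⟩
      map_add' := fun s t => Subtype.ext (smul_add _ _ _)
      map_smul' := fun c s => Subtype.ext (smul_comm _ _ _) }
  map_add' x y := by
    ext l s : 3
    exact add_smul _ _ _
  map_smul' c x := by
    ext l s : 3
    exact smul_assoc _ _ _

theorem symm_smul {f : Fin n → ℕ} {N : Type*} [AddCommGroup N] [Module ℂ N]
    [Module (GrpAlg n) N] [IsScalarTower ℂ (GrpAlg n) N] {x : N} (hx : x ∈ invariantsOf f N) :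
    symm f • x = ((stab f).card : ℂ) • x := by
  rw [symm, Finset.sum_smul, Finset.sum_congr rfl hx, Finset.sum_const, Nat.cast_smul_eq_nsmul]

/-- An element `r` realizing the maps need not itself be invariant, but averaging it over `stab f`
makes it so and leaves the maps unchanged, their values being invariant already. -/
theorem invariantsAction_surjective (f : Fin n → ℕ) :
    Function.Surjective (invariantsAction f) := by
  intro T
  obtain ⟨r, hr⟩ := exists_smul_eq fun l => (invariantsOf f (Specht l)).subtype ∘ₗ T l
  have hcard : ((stab f).card : ℂ) ≠ 0 := by
    have := Finset.card_pos.2 ⟨1, one_mem_stab f⟩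
    exact_mod_cast this.ne'
  refine ⟨⟨((stab f).card : ℂ)⁻¹ • (symm f * r), fun w hw => ?_⟩, ?_⟩
  · rw [smul_comm, smul_eq_mul, ← mul_assoc, perm_mul_symm hw]
  · ext l s : 3
    change (((stab f).card : ℂ)⁻¹ • (symm f * r)) • s = (T l s).1
    rw [smul_assoc, mul_smul, hr]
    change _ • symm f • (T l s).1 = _
    rw [symm_smul (T l s).2, smul_smul, inv_mul_cancel₀ hcard, one_smul]

theorem finrank_invariantsAction_target (f : Fin n → ℕ) :
    Module.finrank ℂ ((l : Part n) → Specht l →ₗ[ℂ] invariantsOf f (Specht l)) =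
      ∑ l : Part n, Module.finrank ℂ (Specht l) *
        Module.finrank ℂ (invariantsOf f (Specht l)) := by
  rw [Module.finrank_pi_fintype]
  refine Finset.sum_congr rfl fun l _ => ?_
  have : Module.Free ℂ (invariantsOf f (Specht l)) :=
    Module.Free.of_divisionRing ℂ (invariantsOf f (Specht l))
  have : Module.Free ℂ (Specht l) := Module.Free.of_divisionRing ℂ (Specht l)
  exact Module.finrank_linearMap ℂ ℂ (Specht l) (invariantsOf f (Specht l))

/-- An invariant element has constant coefficients on the cosets `stab f * g`, and such a coset is
determined by the word `f ∘ g`. -/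
theorem finrank_invariantsOf_groupAlgebra_le {f : Fin n → ℕ} {m : ℕ →₀ ℕ}
    (hf : ∀ i, (Finset.univ.filter fun k => f k = i).card = m i) :
    Module.finrank ℂ (invariantsOf f (GrpAlg n)) ≤ Nat.card (Word n m) := by
  have hg : ∀ a : Word n m, ∃ g : SymGrp n, ∀ k, f (g k) = a.1 k := fun a =>
    exists_equiv_comp _ _ fun i => by rw [hf, a.2]
  choose g hg using hg
  have := Fintype.ofFinite (Word n m)
  let ev : invariantsOf f (GrpAlg n) →ₗ[ℂ] (Word n m → ℂ) :=
    LinearMap.pi fun a => coeffAt (g a) ∘ₗ (invariantsOf f (GrpAlg n)).subtype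
  have hev : Function.Injective ev := by
    rw [injective_iff_map_eq_zero]
    intro x hx
    refine Subtype.ext (MonoidAlgebra.ext (Finsupp.ext fun h => ?_))
    let a : Word n m := ⟨fun k => f (h k), fun i => by
      rw [← hf i]
      exact Finset.card_bij (fun k _ => h k) (by simp) (fun _ _ _ _ e => h.injective e)
        (fun k hk => ⟨h⁻¹ k, by simpa using hk, by simp⟩)⟩
    have hw : g a * h⁻¹ ∈ stab f := mem_stab.2 fun k => by
      rw [Equiv.Perm.mul_apply, hg]
      simp [a]
    have h1 := x.2 _ (inv_mem_stab hw)
    have h2 : x.1.coeff (g a) = 0 := congrFun hx a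
    rw [← h1, smul_eq_mul, perm, MonoidAlgebra.of_apply, MonoidAlgebra.coeff_single_mul_apply]
    simpa using h2
  have h1 := LinearMap.finrank_le_finrank_of_injective hev
  rwa [Module.finrank_fintype_fun_eq_card, ← Nat.card_eq_fintype_card] at h1

theorem card_filter_val (n i : ℕ) :
    (Finset.univ.filter fun k : Fin n => (k : ℕ) = i).card = stdContent n i := by
  rw [stdContent_apply]
  split_ifs with h
  · rw [Finset.card_eq_one]
    refine ⟨⟨i, h⟩, ?_⟩
    ext k
    simp [Fin.ext_iff]
  · rw [Finset.card_eq_zero, Finset.filter_eq_empty_iff]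
    intro k _
    have := k.2
    omega

theorem kostka_std_le_finrank (l : Part n) :
    kostka l.1 (stdContent n) ≤ Module.finrank ℂ (Specht l) :=
  (kostka_le_finrank l (card_filter_val n)).trans (Submodule.finrank_le _)

theorem exists_labelling {m : ℕ →₀ ℕ} (hm : m.degree = n) :
    ∃ f : Fin n → ℕ, ∀ i, (Finset.univ.filter fun k => f k = i).card = m i := by
  have hcard : Fintype.card (Fin n) = Fintype.card (Σ i : m.support, Fin (m i)) := by
    rw [Fintype.card_fin, Fintype.card_sigma, ← hm, Finsupp.degree_apply]
    simp only [Fintype.card_fin]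
    rw [Finset.sum_coe_sort m.support fun i => m i]
  let e := (Fintype.equivOfCardEq hcard)
  refine ⟨fun k => (e k).1, fun i => ?_⟩
  have h1 : (Finset.univ.filter fun k => ((e k).1 : ℕ) = i).card =
      (Finset.univ.filter fun p : Σ i : m.support, Fin (m i) => (p.1 : ℕ) = i).card :=
    Finset.card_bij (fun k _ => e k) (by simp) (fun _ _ _ _ h => e.injective h)
      (fun p hp => ⟨e.symm p, by simpa using hp, by simp⟩)
  rw [h1]
  by_cases hi : i ∈ m.support
  · have : (Finset.univ.filter fun p : Σ i : m.support, Fin (m i) => (p.1 : ℕ) = i) =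
        (Finset.univ : Finset (Fin (m i))).map
          (Function.Embedding.sigmaMk (β := fun i : m.support => Fin (m i)) ⟨i, hi⟩) := by
      ext ⟨⟨j, hj⟩, q⟩
      simp only [Finset.mem_filter, Finset.mem_univ, true_and, Finset.mem_map]
      constructor
      · rintro rfl
        exact ⟨q, rfl⟩
      · rintro ⟨q', h⟩
        have := congrArg (fun p => (p.1 : ℕ)) h
        exact this.symm
    rw [this, Finset.card_map, Finset.card_univ, Fintype.card_fin]
  · rw [Finsupp.notMem_support_iff.1 hi, Finset.card_eq_zero, Finset.filter_eq_empty_iff]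
    rintro ⟨⟨j, hj⟩, q⟩ _ rfl
    exact hi hj

theorem degree_eq_card {α : Type*} (s : Finset α) (f : α → ℕ) {m : ℕ →₀ ℕ}
    (hf : ∀ i, (s.filter fun k => f k = i).card = m i) : m.degree = s.card := by
  have h : s.card = ∑ i ∈ m.support, (s.filter fun k => f k = i).card := by
    refine Finset.card_eq_sum_card_fiberwise fun k hk => ?_
    rw [Finset.mem_coe, Finsupp.mem_support_iff, ← hf, Finset.card_ne_zero]
    exact ⟨k, by simpa using hk⟩
  rw [Finsupp.degree_apply, h]
  exact Finset.sum_congr rfl fun i _ => (hf i).symm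

theorem degree_eq_of_labelling {f : Fin n → ℕ} {m : ℕ →₀ ℕ}
    (hf : ∀ i, (Finset.univ.filter fun k => f k = i).card = m i) : m.degree = n := by
  rw [degree_eq_card _ f hf, Finset.card_univ, Fintype.card_fin]

theorem finrank_target_le (f : Fin n → ℕ) :
    ∑ l : Part n, Module.finrank ℂ (Specht l) * Module.finrank ℂ (invariantsOf f (Specht l)) ≤
      Module.finrank ℂ (invariantsOf f (GrpAlg n)) := by
  rw [← finrank_invariantsAction_target]
  exact LinearMap.finrank_le_finrank_of_surjective (invariantsAction_surjective f)

/-- Young's rule: the invariants of a Young subgroup in a Specht module are counted by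
semistandard tableaux. -/
theorem finrank_invariantsOf_specht {f : Fin n → ℕ} {m : ℕ →₀ ℕ}
    (hf : ∀ i, (Finset.univ.filter fun k => f k = i).card = m i) (l : Part n) :
    Module.finrank ℂ (invariantsOf f (Specht l)) = kostka l.1 m := by
  refine le_antisymm ?_ (kostka_le_finrank l hf)
  by_contra! hlt
  -- A strict inequality at one `l`, weighted by the positive dimension of its Specht module, would
  -- make the first member of the sandwich smaller than the last.
  have h1 := (finrank_target_le f).trans ((finrank_invariantsOf_groupAlgebra_le hf).trans
    (card_word_le_sum_kostka n m (degree_eq_of_labelling hf)))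
  refine absurd h1 (not_le.2 (Finset.sum_lt_sum (fun l' _ => ?_) ⟨l, Finset.mem_univ l, ?_⟩))
  · rw [mul_comm]
    exact Nat.mul_le_mul (kostka_std_le_finrank l') (kostka_le_finrank l' hf)
  · have hpos : 0 < Module.finrank ℂ (Specht l) :=
      have := IsSimpleModule.nontrivial (GrpAlg n) (Specht l)
      Module.finrank_pos
    have := kostka_std_le_finrank l
    nlinarith

/-! ### Faithfulness on the Specht modules and decomposition into them -/

theorem eq_zero_of_forall_smul_specht {x : GrpAlg n} (hx : ∀ (l : Part n) (s : Specht l), x • s = 0) :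
    x = 0 := by
  -- For distinct labels the stabilizer is trivial and every element is invariant, so the sandwich
  -- concerns the whole group algebra: the surjection is between spaces of equal dimension, hence
  -- injective.
  let f : Fin n → ℕ := fun k => k
  have hmem : ∀ x : GrpAlg n, x ∈ invariantsOf f (GrpAlg n) := by
    intro x w hw
    have : w = 1 := Equiv.ext fun k => Fin.ext (mem_stab.1 hw k)
    rw [this, perm, map_one, one_smul]
  have h1 := (finrank_invariantsOf_groupAlgebra_le (card_filter_val n)).trans
    (card_word_le_sum_kostka n _ (degree_eq_of_labelling (card_filter_val n)))
  have h2 : Module.finrank ℂ (invariantsOf f (GrpAlg n)) = Module.finrank ℂ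
      ((l : Part n) → Specht l →ₗ[ℂ] invariantsOf f (Specht l)) := by
    refine le_antisymm ?_
      (LinearMap.finrank_le_finrank_of_surjective (invariantsAction_surjective f))
    rw [finrank_invariantsAction_target]
    refine h1.trans (Finset.sum_le_sum fun l _ => ?_)
    exact Nat.mul_le_mul (kostka_std_le_finrank l) (kostka_le_finrank l (card_filter_val n))
  have h3 := (LinearMap.injective_iff_surjective_of_finrank_eq_finrank h2).2
    (invariantsAction_surjective f)
  have h4 : invariantsAction f ⟨x, hmem x⟩ = 0 := by
    ext l s : 3
    exact hx l s
  exact congrArg Subtype.val (h3 (h4.trans (map_zero _).symm))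

/-- A simple module embeds as a left ideal. A nonzero element of it acts nontrivially on some Specht
module, and this yields a nonzero map between simple modules. -/
theorem exists_equiv_specht (L : Type*) [AddCommGroup L] [Module (GrpAlg n) L]
    [IsSimpleModule (GrpAlg n) L] : ∃ l : Part n, Nonempty (L ≃ₗ[GrpAlg n] Specht l) := by
  obtain ⟨I, ⟨e⟩⟩ := IsSemisimpleRing.exists_linearEquiv_ideal_of_isSimpleModule (GrpAlg n) L
  have := IsSimpleModule.nontrivial (GrpAlg n) L
  obtain ⟨x, hx⟩ := exists_ne (0 : L)
  have h1 : (e x).1 ≠ 0 := fun h => hx (e.map_eq_zero_iff.1 (Subtype.ext h))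
  obtain ⟨l, s, hs⟩ : ∃ (l : Part n) (s : Specht l), (e x).1 • s ≠ 0 := by
    by_contra! h
    exact h1 (eq_zero_of_forall_smul_specht h)
  let φ : L →ₗ[GrpAlg n] Specht l :=
    LinearMap.toSpanSingleton (GrpAlg n) (Specht l) s ∘ₗ I.subtype ∘ₗ e.toLinearMap
  have hφ : φ ≠ 0 := fun h => hs (LinearMap.congr_fun h x)
  exact ⟨l, ⟨LinearEquiv.ofBijective φ (LinearMap.bijective_of_ne_zero hφ)⟩⟩

theorem exists_multiplicities (N : Type*) [AddCommGroup N] [Module (GrpAlg n) N]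
    [Module.Finite (GrpAlg n) N] :
    ∃ m : Part n → ℕ, Nonempty (N ≃ₗ[GrpAlg n] ((l : Part n) → Fin (m l) → Specht l)) := by
  obtain ⟨k, S, e, hS⟩ := IsSemisimpleModule.exists_linearEquiv_fin_dfinsupp (GrpAlg n) N
  have hex : ∀ i, ∃ l : Part n, Nonempty (S i ≃ₗ[GrpAlg n] Specht l) := fun i =>
    have := hS i
    exists_equiv_specht (S i)
  choose t ht using hex
  refine ⟨fun l => Fintype.card {i // t i = l}, ⟨?_⟩⟩
  let E : (Σ l : Part n, Fin (Fintype.card {i // t i = l})) ≃ Fin k :=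
    (Equiv.sigmaCongrRight fun l => (Fintype.equivFin {i // t i = l}).symm).trans
      (Equiv.sigmaFiberEquiv t)
  have hE : ∀ p, t (E p) = p.1 := fun p => ((Fintype.equivFin {i // t i = p.1}).symm p.2).2
  have e1 : N ≃ₗ[GrpAlg n] ((i : Fin k) → S i) := e.trans DFinsupp.linearEquivFunOnFintype
  have e2 : ((p : Σ l : Part n, Fin (Fintype.card {i // t i = l})) → S (E p)) ≃ₗ[GrpAlg n]
      ((i : Fin k) → S i) := LinearEquiv.piCongrLeft (GrpAlg n) (fun i => S i) E
  have e3 : ((p : Σ l : Part n, Fin (Fintype.card {i // t i = l})) → S (E p)) ≃ₗ[GrpAlg n]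
      ((p : Σ l : Part n, Fin (Fintype.card {i // t i = l})) → Specht p.1) :=
    LinearEquiv.piCongrRight fun p => (ht (E p)).some.trans
      (LinearEquiv.ofEq _ _ (by rw [hE]))
  exact (e1.trans e2.symm).trans (e3.trans
    (LinearEquiv.piCurry (GrpAlg n) fun (l : Part n) (_ : Fin _) => Specht l))

/-! ### The Frobenius image through invariants -/

theorem finrank_invariantsOf_congr (f : Fin n → ℕ) {N N' : Type*} [AddCommGroup N] [Module ℂ N]
    [Module (GrpAlg n) N] [IsScalarTower ℂ (GrpAlg n) N] [AddCommGroup N'] [Module ℂ N']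
    [Module (GrpAlg n) N'] [IsScalarTower ℂ (GrpAlg n) N'] (e : N ≃ₗ[GrpAlg n] N') :
    Module.finrank ℂ (invariantsOf f N) = Module.finrank ℂ (invariantsOf f N') := by
  refine LinearEquiv.finrank_eq (LinearEquiv.ofSubmodules (e.restrictScalars ℂ) _ _ ?_)
  ext y
  simp only [Submodule.mem_map, mem_invariantsOf]
  constructor
  · rintro ⟨x, hx, rfl⟩ w hw
    change perm w • e x = e x
    rw [← map_smul, hx w hw]
  · intro hy
    refine ⟨e.symm y, fun w hw => ?_, e.apply_symm_apply y⟩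
    rw [← map_smul, hy w hw]

theorem finrank_invariantsOf_pi (f : Fin n → ℕ) {ι : Type*} [Fintype ι] (N : ι → Type*)
    [∀ i, AddCommGroup (N i)] [∀ i, Module ℂ (N i)] [∀ i, Module (GrpAlg n) (N i)]
    [∀ i, IsScalarTower ℂ (GrpAlg n) (N i)] [∀ i, Module.Finite ℂ (N i)] :
    Module.finrank ℂ (invariantsOf f ((i : ι) → N i)) =
      ∑ i, Module.finrank ℂ (invariantsOf f (N i)) := by
  let e : invariantsOf f ((i : ι) → N i) ≃ₗ[ℂ] ((i : ι) → invariantsOf f (N i)) :=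
    { toFun := fun x i => ⟨x.1 i, fun w hw => congrFun (x.2 w hw) i⟩
      invFun := fun y => ⟨fun i => (y i).1, fun w hw => funext fun i => (y i).2 w hw⟩
      map_add' := fun _ _ => rfl
      map_smul' := fun _ _ => rfl
      left_inv := fun _ => rfl
      right_inv := fun _ => rfl }
  rw [e.finrank_eq, Module.finrank_pi_fintype]

theorem exists_isMultiplicity {V : Type*} [AddCommGroup V] [Module ℂ V] [Module.Finite ℂ V]
    (ρ : Representation ℂ (SymGrp n) V) : ∃ m, IsMultiplicity ρ m := by
  have : Module.Finite (GrpAlg n) ρ.asModule := Module.Finite.of_restrictScalars_finite ℂ _ _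
  exact exists_multiplicities ρ.asModule

theorem frob_eq_sum {V : Type*} [AddCommGroup V] [Module ℂ V] [Module.Finite ℂ V]
    (ρ : Representation ℂ (SymGrp n) V) :
    ∃ m, IsMultiplicity ρ m ∧ frob ρ = ∑ l, (m l : ℂ) • schur l.1 := by
  have h := exists_isMultiplicity ρ
  exact ⟨h.choose, h.choose_spec, dif_pos h⟩

theorem coeff_schur (l : YoungDiagram) (m : ℕ →₀ ℕ) :
    MvPowerSeries.coeff m (schur l) = kostka l m := rfl

/-- Invariants are additive over direct sums, so Young's rule evaluates each summand. The answer
does not depend on which multiplicities `frob` selects. -/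
theorem coeff_frob {V : Type*} [AddCommGroup V] [Module ℂ V] [Module.Finite ℂ V]
    (ρ : Representation ℂ (SymGrp n) V) {f : Fin n → ℕ} {m : ℕ →₀ ℕ}
    (hf : ∀ i, (Finset.univ.filter fun k => f k = i).card = m i) :
    MvPowerSeries.coeff m (frob ρ) = Module.finrank ℂ (invariantsOf f ρ.asModule) := by
  obtain ⟨M, ⟨e⟩, hM⟩ := frob_eq_sum ρ
  rw [hM, finrank_invariantsOf_congr f e, finrank_invariantsOf_pi]
  simp only [finrank_invariantsOf_pi, finrank_invariantsOf_specht hf, map_sum, map_smul,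
    coeff_schur]
  simp

theorem kostka_eq_zero (l : Part n) {m : ℕ →₀ ℕ} (hm : m.degree ≠ n) : kostka l.1 m = 0 := by
  have : {T : SemistandardYoungTableau l.1 |
      ∀ i, (l.1.cells.filter fun c => T c.1 c.2 = i).card = m i} = ∅ := by
    rw [Set.eq_empty_iff_forall_notMem]
    intro T hT
    refine hm (degree_eq_of_labelling (f := entries l T) fun i => ?_)
    rw [← hT]
    convert (card_filter_cells l fun c => T c.1 c.2 = i).symm
    rfl
  rw [kostka, this, Set.ncard_empty]

theorem coeff_frob_of_degree_ne {V : Type*} [AddCommGroup V] [Module ℂ V] [Module.Finite ℂ V]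
    (ρ : Representation ℂ (SymGrp n) V) {m : ℕ →₀ ℕ} (hm : m.degree ≠ n) :
    MvPowerSeries.coeff m (frob ρ) = 0 := by
  obtain ⟨M, -, hM⟩ := frob_eq_sum ρ
  simp [hM, coeff_schur, kostka_eq_zero _ hm]

end Density

end Positroid
end

noncomputable section

namespace Positroid

open Classical

/-! ### Positions of the letters -/

section Letters

variable {n : ℕ}

/-- The number of zeros of a word. -/
def numZeros (v : Fin n → ℕ) : ℕ := (Finset.univ.filter fun k => v k = 0).card

/-- The letters `1, …, n - j` occupy `n - j` distinct positions, which is the number of nonzero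
positions; hence no other nonzero letter occurs. -/
theorem exists_positions (v : P n) : ∃ pos : Fin (n - numZeros v.1) → Fin n,
    (∀ t, v.1 (pos t) = t + 1) ∧ ∀ k, v.1 k ≠ 0 → ∃ t, pos t = k := by
  obtain ⟨j, hj, hz, h1⟩ := v.2
  have hz : numZeros v.1 = j := hz
  have hex : ∀ t : Fin (n - numZeros v.1), ∃ k, v.1 k = t + 1 := by
    intro t
    have := h1 (t + 1) (by omega) (by omega)
    obtain ⟨k, hk⟩ := Finset.card_pos.1 (this ▸ Nat.one_pos)
    exact ⟨k, (Finset.mem_filter.1 hk).2⟩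
  choose pos hpos using hex
  refine ⟨pos, hpos, fun k hk => ?_⟩
  have hinj : Function.Injective pos := fun s t h => by
    have := hpos s
    rw [h, hpos t] at this
    exact Fin.ext (by omega)
  have heq : Finset.univ.image pos = Finset.univ.filter fun k => v.1 k ≠ 0 := by
    refine Finset.eq_of_subset_of_card_le ?_ ?_
    · intro k hk
      obtain ⟨t, -, rfl⟩ := Finset.mem_image.1 hk
      simp [hpos]
    · rw [Finset.card_image_of_injective _ hinj, Finset.card_univ, Fintype.card_fin]
      have := Finset.card_filter_add_card_filter_not (s := (Finset.univ : Finset (Fin n)))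
        (fun k => v.1 k = 0)
      rw [Finset.card_univ, Fintype.card_fin] at this
      simp only [numZeros, ne_eq]
      omega
  have : k ∈ Finset.univ.image pos := heq ▸ by simpa using hk
  obtain ⟨t, -, ht⟩ := Finset.mem_image.1 this
  exact ⟨t, ht⟩

theorem eq_of_letter_eq (v : P n) {k k' : Fin n} (h : v.1 k = v.1 k') (hk : v.1 k ≠ 0) :
    k = k' := by
  obtain ⟨pos, hpos, hsurj⟩ := exists_positions v
  obtain ⟨t, rfl⟩ := hsurj k hk
  obtain ⟨t', rfl⟩ := hsurj k' (h ▸ hk)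
  rw [hpos, hpos] at h
  rw [Fin.ext (show (t : ℕ) = t' by omega)]

end Letters

/-! ### The signed action -/

section SignedAction

variable {n : ℕ}

/-- The sign of a pair of letters: `-1` for an inversion. -/
def pairSign (a b : ℕ) : ℂ := if b < a then -1 else 1

theorem pairSign_swap {a b : ℕ} (h : a ≠ b) : pairSign b a = -pairSign a b := by
  rcases lt_or_gt_of_ne h with h | h <;> simp [pairSign, h, h.le.not_gt]

theorem pairSign_mul_self (a b : ℕ) : pairSign a b * pairSign a b = 1 := by
  unfold pairSign
  split_ifs <;> simp

/-- The parity of the number of inversions of a word. -/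
def invSign (v : Fin n → ℕ) : ℂ :=
  ∏ p : Fin n × Fin n with p.1 < p.2, pairSign (v p.1) (v p.2)

theorem invSign_mul_self (v : Fin n → ℕ) : invSign v * invSign v = 1 := by
  rw [invSign, ← Finset.prod_mul_distrib]
  exact Finset.prod_eq_one fun p _ => pairSign_mul_self _ _

theorem adj_lt_adj {i : ℕ} (hi : i + 1 < n) {a b : Fin n} (hab : a < b)
    (hne : ¬(a = ⟨i, Nat.lt_of_succ_lt hi⟩ ∧ b = ⟨i + 1, hi⟩)) : adj i hi a < adj i hi b := by
  simp only [adj, Equiv.swap_apply_def, Fin.ext_iff, Fin.lt_def] at *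
  split_ifs <;> simp_all <;> omega

theorem adj_adj {i : ℕ} (hi : i + 1 < n) (k : Fin n) : adj i hi (adj i hi k) = k :=
  Equiv.swap_apply_self _ _ _

/-- The transposition permutes the increasing pairs of positions other than `(i, i + 1)`, so only
that one factor changes, and it changes sign. -/
theorem invSign_comp_adj {i : ℕ} (hi : i + 1 < n) (v : Fin n → ℕ)
    (hv : v ⟨i, Nat.lt_of_succ_lt hi⟩ ≠ v ⟨i + 1, hi⟩) :
    invSign (v ∘ adj i hi) = -invSign v := by
  set a : Fin n := ⟨i, Nat.lt_of_succ_lt hi⟩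
  set b : Fin n := ⟨i + 1, hi⟩
  have ha : adj i hi a = b := Equiv.swap_apply_left _ _
  have hb : adj i hi b = a := Equiv.swap_apply_right _ _
  have hmem : (a, b) ∈ Finset.univ.filter fun p : Fin n × Fin n => p.1 < p.2 :=
    Finset.mem_filter.2 ⟨Finset.mem_univ _, Nat.lt_succ_self i⟩
  rw [invSign, invSign, ← Finset.mul_prod_erase _ _ hmem, ← Finset.mul_prod_erase _ _ hmem]
  simp only [Function.comp_apply, ha, hb]
  rw [pairSign_swap hv, neg_mul, neg_inj]
  congr 1
  have hmaps : ∀ p ∈ (Finset.univ.filter fun p : Fin n × Fin n => p.1 < p.2).erase (a, b),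
      (adj i hi p.1, adj i hi p.2) ∈
        (Finset.univ.filter fun p : Fin n × Fin n => p.1 < p.2).erase (a, b) := by
    rintro ⟨x, y⟩ hp
    simp only [Finset.mem_erase, Finset.mem_filter, Finset.mem_univ, true_and, ne_eq,
      Prod.mk.injEq] at hp ⊢
    refine ⟨?_, adj_lt_adj hi hp.2 hp.1⟩
    rintro ⟨h1, h2⟩
    have hx : x = b := by rw [← adj_adj hi x, h1, ha]
    have hy : y = a := by rw [← adj_adj hi y, h2, hb]
    have := hp.2
    rw [hx, hy] at this
    exact absurd this (not_lt.2 (Nat.le_succ i))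
  exact Finset.prod_nbij' (fun p => (adj i hi p.1, adj i hi p.2))
    (fun p => (adj i hi p.1, adj i hi p.2)) hmaps hmaps (fun p _ => by simp [adj_adj])
    (fun p _ => by simp [adj_adj]) (fun p _ => rfl)

/-- Permuting the positions of a positroid. -/
def permute (w : SymGrp n) (v : P n) : P n := ⟨v.1 ∘ w, v.2.comp w⟩

theorem permute_apply (w : SymGrp n) (v : P n) (k : Fin n) : (permute w v).1 k = v.1 (w k) := rfl

theorem permute_mul (w w' : SymGrp n) (v : P n) :
    permute (w * w') v = permute w' (permute w v) := rfl

theorem permute_one (v : P n) : permute 1 v = v := rfl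

/-- The linear map by which a permutation acts. -/
def signedMap (g : SymGrp n) : (P n →₀ ℂ) →ₗ[ℂ] (P n →₀ ℂ) :=
  Finsupp.linearCombination ℂ fun v =>
    -- Precomposition is a right action, hence the inverse. The factors `invSign` telescope under
    -- composition because their squares are one.
    Finsupp.single (permute g⁻¹ v) (sgn g * invSign v.1 * invSign (permute g⁻¹ v).1)

theorem signedMap_single (g : SymGrp n) (v : P n) (c : ℂ) :
    signedMap g (Finsupp.single v c) = Finsupp.single (permute g⁻¹ v)
      (c * (sgn g * invSign v.1 * invSign (permute g⁻¹ v).1)) := by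
  rw [signedMap, Finsupp.linearCombination_single, Finsupp.smul_single, smul_eq_mul]

/-- The signed action of the symmetric group on words. -/
def signedRep (n : ℕ) : Representation ℂ (SymGrp n) (P n →₀ ℂ) where
  toFun := signedMap
  map_one' := by
    refine Finsupp.lhom_ext fun v c => ?_
    rw [signedMap_single, inv_one, permute_one, sgn_one, one_mul, invSign_mul_self, mul_one]
    rfl
  map_mul' g h := by
    refine Finsupp.lhom_ext fun v c => ?_
    rw [Module.End.mul_apply, signedMap_single, signedMap_single, signedMap_single, mul_inv_rev,
      permute_mul, sgn_mul]
    congr 1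
    linear_combination (-(c * sgn g * sgn h * invSign v.1 *
      invSign (permute g⁻¹ (permute h⁻¹ v)).1)) * invSign_mul_self (permute h⁻¹ v).1

theorem signedRep_single (g : SymGrp n) (v : P n) (c : ℂ) :
    signedRep n g (Finsupp.single v c) = Finsupp.single (permute g⁻¹ v)
      (c * (sgn g * invSign v.1 * invSign (permute g⁻¹ v).1)) := signedMap_single g v c

/-- For distinct letters the sign of the transposition cancels the change in `invSign`. Equal
letters must be zeros; the word is then fixed and the sign `-1` remains. -/
theorem isSignedAction_signedRep (n : ℕ) : IsSignedAction (signedRep n) := by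
  intro i hi v
  have hinv : (adj i hi)⁻¹ = adj i hi := Equiv.swap_inv _ _
  have hswap : permute (adj i hi) v = swapLetters i hi v := rfl
  have hsgn : sgn (adj i hi) = -1 := by
    have : (⟨i, Nat.lt_of_succ_lt hi⟩ : Fin n) ≠ ⟨i + 1, hi⟩ := by simp [Fin.ext_iff]
    simp [sgn, adj, Equiv.Perm.sign_swap this]
  rw [signedRep_single, hinv, hswap, hsgn, one_mul]
  by_cases hv : v.1 ⟨i, Nat.lt_of_succ_lt hi⟩ = v.1 ⟨i + 1, hi⟩
  · have hself : swapLetters i hi v = v := by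
      refine Subtype.ext (funext fun k => ?_)
      change v.1 (Equiv.swap _ _ k) = v.1 k
      rw [Equiv.swap_apply_def]
      split_ifs with h1 h2
      · rw [h1, hv]
      · rw [h2, hv]
      · rfl
    have h0 : v.1 ⟨i, Nat.lt_of_succ_lt hi⟩ = 0 := by
      by_contra hne
      simpa [Fin.ext_iff] using eq_of_letter_eq v hv hne
    rw [if_pos ⟨h0, hv ▸ h0⟩, hself, mul_assoc, invSign_mul_self, mul_one, Finsupp.single_neg]
  · rw [if_neg fun h => hv (h.1.trans h.2.symm)]
    have : invSign (swapLetters i hi v).1 = -invSign v.1 := invSign_comp_adj hi v.1 hv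
    rw [this]
    congr 1
    linear_combination invSign_mul_self v.1

theorem eq_of_isSignedAction {ρ ρ' : Representation ℂ (SymGrp n) (P n →₀ ℂ)}
    (h : IsSignedAction ρ) (h' : IsSignedAction ρ') : ρ = ρ' := by
  have hadj : ∀ (i : ℕ) (hi : i + 1 < n), ρ (adj i hi) = ρ' (adj i hi) := by
    intro i hi
    refine Finsupp.lhom_ext' fun v => LinearMap.ext_ring ?_
    change ρ (adj i hi) (Finsupp.single v 1) = ρ' (adj i hi) (Finsupp.single v 1)
    rw [h i hi v, h' i hi v]
  cases n with
  | zero =>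
    refine MonoidHom.ext fun g => ?_
    rw [Subsingleton.elim g 1, map_one, map_one]
  | succ n =>
    refine MonoidHom.eq_of_eqOn_denseM (Equiv.Perm.mclosure_swap_castSucc_succ n) ?_
    rintro _ ⟨i, rfl⟩
    exact hadj i (by omega)

end SignedAction

end Positroid
end

noncomputable section

namespace Positroid

open Classical

/-! ### Invariants of the signed action -/

section Fits

variable {n : ℕ}

instance instFiniteP : Finite (P n) := by
  have hlt : ∀ (v : P n) (k : Fin n), v.1 k < n + 1 := by
    intro v k
    obtain ⟨pos, hpos, hsurj⟩ := exists_positions v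
    by_cases hk : v.1 k = 0
    · omega
    · obtain ⟨t, rfl⟩ := hsurj k hk
      have := hpos t
      have := t.2
      omega
  refine Finite.of_injective (fun v : P n => fun k => (⟨v.1 k, hlt v k⟩ : Fin (n + 1))) ?_
  intro v v' h
  exact Subtype.ext (funext fun k => congrArg Fin.val (congrFun h k))

/-- The pairs of a set of labels (for the zeros) and a word of labels (for the other letters) of
total content `m`. -/
abbrev LabelPair (n : ℕ) (m : ℕ →₀ ℕ) : Type :=
  Σ p : {p // p ∈ (Finset.HasAntidiagonal.antidiagonal m).filter fun p => ∀ i, p.1 i ≤ 1},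
    Word (n - p.1.1.degree) p.1.2

/-- The labels of the letters of `v` under the labelling `f` of the positions are given by `q`. -/
def Fits (f : Fin n → ℕ) {m : ℕ →₀ ℕ} (v : Fin n → ℕ) (q : LabelPair n m) : Prop :=
  (∀ i, ((Finset.univ.filter fun k => v k = 0).filter fun k => f k = i).card = q.1.1.1 i) ∧
    ∀ (t : Fin (n - q.1.1.1.degree)) (k : Fin n), v k = t + 1 → f k = q.2.1 t

theorem LabelPair.le_one {m : ℕ →₀ ℕ} (q : LabelPair n m) (i : ℕ) : q.1.1.1 i ≤ 1 :=
  (Finset.mem_filter.1 q.1.2).2 i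

theorem LabelPair.add_eq {m : ℕ →₀ ℕ} (q : LabelPair n m) : q.1.1.1 + q.1.1.2 = m :=
  Finset.HasAntidiagonal.mem_antidiagonal.1 (Finset.mem_filter.1 q.1.2).1

variable {f : Fin n → ℕ} {m : ℕ →₀ ℕ}

theorem Fits.degree_eq {v : Fin n → ℕ} {q : LabelPair n m} (h : Fits f v q) :
    q.1.1.1.degree = numZeros v := degree_eq_card _ f h.1

/-- No two zeros of the word have the same label. -/
def ZerosApart (f v : Fin n → ℕ) : Prop :=
  ∀ k k', v k = 0 → v k' = 0 → f k = f k' → k = k'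

theorem Fits.zerosApart {v : Fin n → ℕ} {q : LabelPair n m} (h : Fits f v q) :
    ZerosApart f v := by
  intro k k' hk hk' hf
  have h1 := (h.1 (f k)).le.trans (q.le_one (f k))
  exact Finset.card_le_one.1 h1 k (by simp [hk]) k' (by simp [hk', hf])

/-- The labels of the zeros together with the label word have total content `m`, as `f` does.
Positions can therefore be matched with these slots, and the slots dictate the letters. -/
theorem exists_fits (hf : ∀ i, (Finset.univ.filter fun k => f k = i).card = m i)
    (q : LabelPair n m) : ∃ v : P n, Fits f v.1 q := by
  let g : {i // i ∈ q.1.1.1.support} ⊕ Fin (n - q.1.1.1.degree) → ℕ :=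
    Sum.elim (fun i => i.1) q.2.1
  have hone : ∀ i ∈ q.1.1.1.support, q.1.1.1 i = 1 := fun i hi => by
    have := q.le_one i
    have := Finsupp.mem_support_iff.1 hi
    omega
  have hsupp : ∀ i, (∑ x : {i // i ∈ q.1.1.1.support}, if x.1 = i then 1 else 0) = q.1.1.1 i := by
    intro i
    rw [Finset.sum_coe_sort q.1.1.1.support fun x => if x = i then 1 else 0, Finset.sum_ite_eq']
    split_ifs with h
    · exact (hone i h).symm
    · exact (Finsupp.notMem_support_iff.1 h).symm
  obtain ⟨e, he⟩ := exists_equiv_comp f g fun i => by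
    have hadd : m i = q.1.1.1 i + q.1.1.2 i := by rw [← Finsupp.add_apply, q.add_eq]
    rw [hf, hadd, Finset.card_filter, Fintype.sum_sum_type]
    exact congrArg₂ (· + ·) (hsupp i).symm (by rw [← q.2.2, Finset.card_filter]; rfl)
  let v : Fin n → ℕ := fun k => Sum.elim (fun _ => 0) (fun t : Fin (n - q.1.1.1.degree) => (t : ℕ) + 1) (e k)
  have hfits : Fits f v q := by
    constructor
    · intro i
      rw [← hsupp i, Finset.filter_filter, Finset.card_filter, ← Equiv.sum_comp e.symm,
        Fintype.sum_sum_type]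
      simp [v, ← he, g]
    · intro t k hk
      rw [← he]
      rcases h : e k with x | t'
      · simp [v, h] at hk
      · have : t' = t := by
          simp only [v, h, Sum.elim_inr, Nat.add_right_cancel_iff] at hk
          exact Fin.ext hk
        simp [g, this]
  have hdeg := hfits.degree_eq
  refine ⟨⟨v, numZeros v, ?_, rfl, fun b hb hb' => ?_⟩, hfits⟩
  · exact (Finset.card_le_univ _).trans (Fintype.card_fin n).le
  · rw [Finset.card_eq_one]
    refine ⟨e.symm (Sum.inr ⟨b - 1, by omega⟩), ?_⟩
    ext k
    simp only [Finset.mem_filter, Finset.mem_univ, true_and, Finset.mem_singleton,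
      Equiv.eq_symm_apply]
    simp only [v]
    rcases e k with x | t
    · simp
      omega
    · simp only [Sum.elim_inr, Sum.inr.injEq, Fin.ext_iff]
      omega

theorem exists_fits_of_zerosApart
    (hf : ∀ i, (Finset.univ.filter fun k => f k = i).card = m i) {v : P n}
    (hv : ZerosApart f v.1) : ∃ q : LabelPair n m, Fits f v.1 q := by
  have hsub : ∀ i, ((Finset.univ.filter fun k => v.1 k = 0).filter fun k => f k = i).card ≤ m i := by
    intro i
    rw [← hf]
    exact Finset.card_le_card fun k hk => by
      simp only [Finset.mem_filter] at hk ⊢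
      exact ⟨hk.1.1, hk.2⟩
  let p : ℕ →₀ ℕ := Finsupp.onFinset m.support
    (fun i => ((Finset.univ.filter fun k => v.1 k = 0).filter fun k => f k = i).card)
    fun i hi => by
      rw [Finsupp.mem_support_iff]
      have := hsub i
      omega
  have hp : ∀ i, ((Finset.univ.filter fun k => v.1 k = 0).filter fun k => f k = i).card = p i :=
    fun i => rfl
  have hdeg : p.degree = numZeros v.1 := degree_eq_card _ f hp
  have hle : p ≤ m := hsub
  have hone : ∀ i, p i ≤ 1 := by
    intro i
    rw [← hp]
    refine Finset.card_le_one.2 fun k hk k' hk' => ?_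
    simp only [Finset.mem_filter, Finset.mem_univ, true_and] at hk hk'
    exact hv k k' hk.1 hk'.1 (hk.2.trans hk'.2.symm)
  obtain ⟨pos, hpos, hsurj⟩ := exists_positions v
  have hposinj : Function.Injective pos := fun s t h => by
    have := hpos s
    rw [h, hpos t] at this
    exact Fin.ext (by omega)
  have hdeg' : n - p.degree = n - numZeros v.1 := by rw [hdeg]
  let a : Fin (n - p.degree) → ℕ := fun t => f (pos (Fin.cast hdeg' t))
  have ha : ∀ i, (Finset.univ.filter fun t => a t = i).card = (m - p) i := by
    intro i
    have h1 : (Finset.univ.filter fun t => a t = i).card =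
        ((Finset.univ.filter fun k => ¬ v.1 k = 0).filter fun k => f k = i).card := by
      refine Finset.card_bij (fun t _ => pos (Fin.cast hdeg' t)) (fun t ht => ?_)
        (fun s _ t _ h => Fin.cast_injective _ (hposinj h)) (fun k hk => ?_)
      · simp only [Finset.mem_filter, Finset.mem_univ, true_and] at ht ⊢
        exact ⟨by simp [hpos], ht⟩
      · simp only [Finset.mem_filter, Finset.mem_univ, true_and] at hk
        obtain ⟨t, rfl⟩ := hsurj k hk.1
        exact ⟨Fin.cast hdeg'.symm t, by simpa [a] using hk.2, by simp⟩
    have h2 := Finset.card_filter_add_card_filter_not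
      (s := (Finset.univ.filter fun k => f k = i)) (fun k => v.1 k = 0)
    rw [Finset.filter_comm, Finset.filter_comm (p := fun k => f k = i) (q := fun k => ¬ v.1 k = 0),
      hp, hf, ← h1] at h2
    rw [Finsupp.tsub_apply]
    omega
  refine ⟨⟨⟨(p, m - p), Finset.mem_filter.2 ⟨Finset.HasAntidiagonal.mem_antidiagonal.2 ?_, hone⟩⟩, ⟨a, ha⟩⟩,
    hp, fun t k hk => ?_⟩
  · exact add_tsub_cancel_of_le hle
  · change f k = f (pos (Fin.cast hdeg' t))
    congr 1
    exact eq_of_letter_eq v (hk.trans (hpos (Fin.cast hdeg' t)).symm) (by omega)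

/-- The pair `q` determines how often each combination (letter, label) occurs, so a permutation
matches these combinations; respecting labels places it in `stab f`. -/
theorem Fits.exists_eq_permute {v v' : P n} {q : LabelPair n m} (h : Fits f v.1 q)
    (h' : Fits f v'.1 q) : ∃ w ∈ stab f, v' = permute w v := by
  have key : ∀ {v : P n}, Fits f v.1 q → ∀ x : ℕ × ℕ,
      (Finset.univ.filter fun k => (v.1 k, f k) = x).card =
        if x.1 = 0 then q.1.1.1 x.2 else
          if hx : x.1 - 1 < n - q.1.1.1.degree then if q.2.1 ⟨x.1 - 1, hx⟩ = x.2 then 1 else 0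
            else 0 := by
    rintro v hv ⟨b, i⟩
    obtain ⟨pos, hpos, hsurj⟩ := exists_positions v
    have hdeg := hv.degree_eq
    simp only [Prod.mk.injEq]
    split_ifs with h1 h2 h3
    · rw [h1, ← hv.1, Finset.filter_filter]
    · rw [Finset.card_eq_one]
      refine ⟨pos ⟨b - 1, by omega⟩, ?_⟩
      ext k
      simp only [Finset.mem_filter, Finset.mem_univ, true_and, Finset.mem_singleton]
      constructor
      · rintro ⟨h4, -⟩
        exact eq_of_letter_eq v (by rw [hpos, h4]; simp only; omega) (by omega)
      · rintro rfl
        have h5 := hpos ⟨b - 1, by omega⟩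
        simp only at h5
        refine ⟨by omega, ?_⟩
        rw [← h3]
        exact hv.2 ⟨b - 1, h2⟩ _ h5
    · rw [Finset.card_eq_zero, Finset.filter_eq_empty_iff]
      rintro k - ⟨h4, h5⟩
      exact h3 (by rw [← hv.2 ⟨b - 1, h2⟩ k (by simp only; omega), h5])
    · rw [Finset.card_eq_zero, Finset.filter_eq_empty_iff]
      rintro k - ⟨h4, h5⟩
      obtain ⟨t, rfl⟩ := hsurj k (by omega)
      have := hpos t
      have := t.2
      omega
  obtain ⟨w, hw⟩ := exists_equiv_comp (fun k => (v'.1 k, f k)) (fun k => (v.1 k, f k))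
    fun x => (key h' x).trans (key h x).symm
  exact ⟨w, mem_stab.2 fun k => congrArg Prod.snd (hw k),
    Subtype.ext (funext fun k => (congrArg Prod.fst (hw k)).symm)⟩

theorem Fits.permute {v : P n} {q : LabelPair n m} (h : Fits f v.1 q) {w : SymGrp n}
    (hw : w ∈ stab f) : Fits f (permute w v).1 q := by
  constructor
  · intro i
    rw [← h.1 i, Finset.filter_filter, Finset.filter_filter]
    refine Finset.card_bij (fun k _ => w k) (fun k hk => ?_) (fun _ _ _ _ e => w.injective e)
      (fun k hk => ⟨w⁻¹ k, ?_, by simp⟩)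
    · simp only [Finset.mem_filter, Finset.mem_univ, true_and] at hk ⊢
      exact ⟨hk.1, by rw [mem_stab.1 hw, hk.2]⟩
    · simp only [Finset.mem_filter, Finset.mem_univ, true_and] at hk ⊢
      exact ⟨by simpa [permute_apply] using hk.1, by rw [mem_stab.1 (inv_mem_stab hw), hk.2]⟩
  · intro t k hk
    rw [← mem_stab.1 hw k]
    exact h.2 t (w k) hk

theorem Fits.unique {v : P n} {q q' : LabelPair n m} (h : Fits f v.1 q) (h' : Fits f v.1 q') :
    q = q' := by
  have hdeg := h.degree_eq
  obtain ⟨pos, hpos, -⟩ := exists_positions v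
  have hq := q.add_eq
  have hq' := q'.add_eq
  obtain ⟨⟨⟨p1, p2⟩, hp⟩, ⟨a, ha⟩⟩ := q
  obtain ⟨⟨⟨p1', p2'⟩, hp'⟩, ⟨a', ha'⟩⟩ := q'
  have h1 : p1 = p1' := by
    ext i
    exact (h.1 i).symm.trans (h'.1 i)
  subst h1
  have h2 : p2 = p2' := add_left_cancel (hq.trans hq'.symm)
  subst h2
  have h3 : a = a' := by
    ext t
    have h4 := hpos ⟨t, by rw [← hdeg]; exact t.2⟩
    exact (h.2 t _ h4).symm.trans (h'.2 t _ h4)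
  subst h3
  rfl

theorem eq_one_of_permute_eq {v : P n} (hv : ZerosApart f v.1) {w : SymGrp n} (hw : w ∈ stab f)
    (h : permute w v = v) : w = 1 := by
  refine Equiv.ext fun k => ?_
  have h1 : v.1 (w k) = v.1 k := congrFun (congrArg Subtype.val h) k
  by_cases h0 : v.1 k = 0
  · exact hv _ _ (h1.trans h0) h0 (mem_stab.1 hw k)
  · exact (eq_of_letter_eq v h1.symm h0).symm

/-- Functions on words that are antisymmetric under the stabilizer of `f`. -/
def IsAlternating (f : Fin n → ℕ) (y : P n → ℂ) : Prop :=
  ∀ w ∈ stab f, ∀ v, y (permute w v) = sgn w * y v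

/-- Exchanging two zeros with the same label fixes the word but has sign `-1`. -/
theorem IsAlternating.eq_zero {y : P n → ℂ} (hy : IsAlternating f y) {v : P n}
    (hv : ¬ ZerosApart f v.1) : y v = 0 := by
  unfold ZerosApart at hv
  push Not at hv
  obtain ⟨k, k', hk, hk', hf, hne⟩ := hv
  have h1 := hy _ (swap_mem_stab hf) v
  have h2 : permute (Equiv.swap k k') v = v := by
    refine Subtype.ext (funext fun x => ?_)
    rw [permute_apply, Equiv.swap_apply_def]
    split_ifs with h h
    · rw [h, hk, hk']
    · rw [h, hk, hk']
    · rfl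
  have h3 : sgn (Equiv.swap k k') = -1 := by simp [sgn, Equiv.Perm.sign_swap hne]
  rw [h2, h3, neg_one_mul] at h1
  exact self_eq_neg.1 h1

theorem signedRep_apply (g : SymGrp n) (x : P n →₀ ℂ) (v : P n) :
    signedRep n g x v = sgn g * invSign v.1 * invSign (permute g v).1 * x (permute g v) := by
  induction x using Finsupp.induction_linear with
  | zero => simp
  | add x y hx hy => rw [map_add, Finsupp.add_apply, hx, hy, Finsupp.add_apply, mul_add]
  | single u c =>
    rw [signedRep_single, Finsupp.single_apply, Finsupp.single_apply]
    have : permute g⁻¹ u = v ↔ u = permute g v := by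
      constructor
      · rintro rfl
        rw [← permute_mul, inv_mul_cancel, permute_one]
      · rintro rfl
        rw [← permute_mul, mul_inv_cancel, permute_one]
    by_cases h : u = permute g v
    · rw [if_pos (this.2 h), if_pos h, this.2 h, h]
      ring
    · rw [if_neg fun h' => h (this.1 h'), if_neg h, mul_zero]

/-- Multiplying by `invSign` undoes the conjugation in the signed action, leaving the sign-twisted
permutation of positions. -/
theorem mem_invariantsOf_signedRep {x : (signedRep n).asModule} :
    x ∈ invariantsOf f (signedRep n).asModule ↔
      IsAlternating f fun v => invSign v.1 * (signedRep n).asModuleEquiv x v := by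
  have hperm : ∀ w : SymGrp n, perm w • x = x ↔
      signedRep n w ((signedRep n).asModuleEquiv x) = (signedRep n).asModuleEquiv x := by
    intro w
    rw [← (signedRep n).asModuleEquiv.injective.eq_iff, Representation.asModuleEquiv_map_smul,
      Representation.asAlgebraHom_of]
  simp only [mem_invariantsOf, IsAlternating, hperm, Finsupp.ext_iff, signedRep_apply]
  set z := (signedRep n).asModuleEquiv x
  refine forall₂_congr fun w _ => forall_congr' fun v => ?_
  have h1 := sgn_mul_self w
  have h2 := invSign_mul_self v.1
  constructor
  · intro h
    linear_combination (sgn w * invSign v.1) * h -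
      (invSign v.1 * invSign v.1 * invSign (permute w v).1 * z (permute w v)) * h1 -
      (invSign (permute w v).1 * z (permute w v)) * h2
  · intro h
    linear_combination (sgn w * invSign v.1) * h + (invSign v.1 * invSign v.1 * z v) * h1 +
      z v * h2

/-- Alternating functions are determined by, and can be prescribed freely at, one representative `r
q` of each orbit on which zeros have distinct labels. -/
theorem finrank_invariantsOf_signedRep
    (hf : ∀ i, (Finset.univ.filter fun k => f k = i).card = m i) :
    Module.finrank ℂ (invariantsOf f (signedRep n).asModule) = Nat.card (LabelPair n m) := by
  choose r hr using exists_fits hf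
  have := Fintype.ofFinite (LabelPair n m)
  let ev : invariantsOf f (signedRep n).asModule →ₗ[ℂ] (LabelPair n m → ℂ) :=
    { toFun := fun x q => invSign (r q).1 * (signedRep n).asModuleEquiv x.1 (r q)
      map_add' := fun x y => funext fun q => mul_add _ _ _
      map_smul' := fun c x => funext fun q => mul_left_comm _ _ _ }
  have hinj : Function.Injective ev := by
    intro x x' hx
    refine Subtype.ext ((signedRep n).asModuleEquiv.injective (Finsupp.ext fun v => ?_))
    have hy := mem_invariantsOf_signedRep.1 x.2
    have hy' := mem_invariantsOf_signedRep.1 x'.2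
    have h0 : invSign v.1 * (signedRep n).asModuleEquiv x.1 v =
        invSign v.1 * (signedRep n).asModuleEquiv x'.1 v := by
      by_cases hv : ZerosApart f v.1
      · obtain ⟨q, hq⟩ := exists_fits_of_zerosApart hf hv
        obtain ⟨w, hw, rfl⟩ := (hr q).exists_eq_permute hq
        have h1 : invSign (r q).1 * (signedRep n).asModuleEquiv x.1 (r q) =
          invSign (r q).1 * (signedRep n).asModuleEquiv x'.1 (r q) := congrFun hx q
        exact (hy w hw (r q)).trans ((congrArg _ h1).trans (hy' w hw (r q)).symm)
      · exact (hy.eq_zero hv).trans (hy'.eq_zero hv).symm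
    have h2 := invSign_mul_self v.1
    exact mul_left_cancel₀ (left_ne_zero_of_mul_eq_one h2) h0
  have hsurj : Function.Surjective ev := by
    intro c
    -- The value `0` is taken on words in which two zeros share a label. Elsewhere the chosen pair
    -- does not matter: the orbit determines `q`, and freeness determines the permutation.
    let y : P n → ℂ := fun v =>
      if h : ∃ p : LabelPair n m × SymGrp n, p.2 ∈ stab f ∧ v = permute p.2 (r p.1)
        then sgn h.choose.2 * c h.choose.1 else 0
    have hy : ∀ q, ∀ w ∈ stab f, y (permute w (r q)) = sgn w * c q := by
      intro q w hw
      have h : ∃ p : LabelPair n m × SymGrp n,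
        p.2 ∈ stab f ∧ permute w (r q) = permute p.2 (r p.1) := ⟨(q, w), hw, rfl⟩
      have h1 : y (permute w (r q)) = sgn h.choose.2 * c h.choose.1 := dif_pos h
      obtain ⟨h2, h3⟩ := h.choose_spec
      generalize h.choose = p at h1 h2 h3
      obtain ⟨q', w'⟩ := p
      simp only at h1 h2 h3
      obtain rfl : q' = q := ((hr q').permute h2).unique (h3 ▸ (hr q).permute hw)
      have h5 : w * w'⁻¹ = 1 := by
        refine eq_one_of_permute_eq (hr q').zerosApart (mul_mem_stab hw (inv_mem_stab h2)) ?_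
        rw [permute_mul, h3, ← permute_mul, mul_inv_cancel, permute_one]
      rw [h1, mul_inv_eq_one.1 h5]
    have halt : IsAlternating f y := by
      intro w hw v
      by_cases hv : ∃ p : LabelPair n m × SymGrp n, p.2 ∈ stab f ∧ v = permute p.2 (r p.1)
      · obtain ⟨⟨q, w'⟩, hw', rfl⟩ := hv
        rw [← permute_mul, hy q _ (mul_mem_stab hw' hw), hy q _ hw', sgn_mul]
        ring
      · have hv' : ¬ ∃ p : LabelPair n m × SymGrp n,
            p.2 ∈ stab f ∧ permute w v = permute p.2 (r p.1) := by
          rintro ⟨⟨q, w'⟩, hw', h⟩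
          refine hv ⟨(q, w' * w⁻¹), mul_mem_stab hw' (inv_mem_stab hw), ?_⟩
          rw [permute_mul, ← h, ← permute_mul, mul_inv_cancel, permute_one]
        simp only [y]
        rw [dif_neg hv, dif_neg hv', mul_zero]
    have hval : ∀ v : P n, invSign v.1 * (Finsupp.equivFunOnFinite.symm fun v : P n => invSign v.1 * y v) v = y v := by
      intro v
      rw [Finsupp.equivFunOnFinite_symm_apply_apply, ← mul_assoc, invSign_mul_self, one_mul]
    refine ⟨⟨(signedRep n).asModuleEquiv.symm
      (Finsupp.equivFunOnFinite.symm fun v : P n => invSign v.1 * y v), ?_⟩, ?_⟩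
    · rw [mem_invariantsOf_signedRep]
      simp only [LinearEquiv.apply_symm_apply, hval]
      exact halt
    · ext q
      change invSign (r q).1 * (signedRep n).asModuleEquiv ((signedRep n).asModuleEquiv.symm _) _ = _
      rw [LinearEquiv.apply_symm_apply, hval]
      simpa [sgn_one, permute_one] using hy q 1 (one_mem_stab f)
  rw [(LinearEquiv.ofBijective ev ⟨hinj, hsurj⟩).finrank_eq, Module.finrank_fintype_fun_eq_card,
    Nat.card_eq_fintype_card]

end Fits

end Positroid
end

noncomputable section

namespace Positroid

open Classical

open Finsupp (single)

/-! ### The coefficients of the symmetric function -/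

/-- The only monomials in `h_1` are the single variables, so this is the recursion of
`card_word_succ`. -/
theorem coeff_hsymm_one_mul (F : MvPowerSeries ℕ ℂ) (m : ℕ →₀ ℕ) :
    MvPowerSeries.coeff m (hsymm 1 * F) =
      ∑ k ∈ m.support, MvPowerSeries.coeff (m - single k 1) F := by
  have h : ∀ p : (ℕ →₀ ℕ) × (ℕ →₀ ℕ),
      MvPowerSeries.coeff p.1 (hsymm 1) * MvPowerSeries.coeff p.2 F =
        if p.1.degree = 1 then MvPowerSeries.coeff p.2 F else 0 := by
    intro p
    change (if p.1.degree = 1 then (1 : ℂ) else 0) * _ = _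
    rw [ite_mul, one_mul, zero_mul]
  rw [MvPowerSeries.coeff_mul, Finset.sum_congr rfl fun p _ => h p, ← Finset.sum_filter]
  symm
  refine Finset.sum_bij (fun k _ => (single k 1, m - single k 1)) (fun k hk => ?_)
    (fun k _ k' _ e => ?_) (fun p hp => ?_) (fun k _ => rfl)
  · rw [Finset.mem_filter, Finset.HasAntidiagonal.mem_antidiagonal]
    refine ⟨add_tsub_cancel_of_le ?_, Finsupp.degree_single _ _⟩
    rw [Finsupp.single_le_iff]
    exact Nat.one_le_iff_ne_zero.2 (Finsupp.mem_support_iff.1 hk)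
  · exact Finsupp.single_left_injective one_ne_zero (Prod.mk.inj e).1
  · rw [Finset.mem_filter, Finset.HasAntidiagonal.mem_antidiagonal] at hp
    obtain ⟨hp, hd⟩ := hp
    obtain ⟨k, hk⟩ : ∃ k, single k 1 = p.1 := by
      have hne : p.1 ≠ 0 := fun h => by simp [h] at hd
      obtain ⟨k, hk⟩ := Finsupp.support_nonempty_iff.2 hne
      have hle : single k 1 ≤ p.1 := by
        rw [Finsupp.single_le_iff]
        exact Nat.one_le_iff_ne_zero.2 (Finsupp.mem_support_iff.1 hk)
      refine ⟨k, ?_⟩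
      have h := congrArg Finsupp.degree (add_tsub_cancel_of_le hle)
      rw [map_add, Finsupp.degree_single, hd, Nat.add_eq_left, Finsupp.degree_eq_zero_iff] at h
      rw [← add_tsub_cancel_of_le hle, h, add_zero]
    refine ⟨k, ?_, ?_⟩
    · rw [Finsupp.mem_support_iff, ← hp, ← hk]
      simp
    · rw [← hp, hk, add_tsub_cancel_left]

theorem coeff_hsymm_one_pow (k : ℕ) (m : ℕ →₀ ℕ) :
    MvPowerSeries.coeff m (hsymm 1 ^ k) = Nat.card (Word k m) := by
  induction k generalizing m with
  | zero => rw [pow_zero, MvPowerSeries.coeff_one, card_word_zero, Nat.cast_ite, Nat.cast_one,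
      Nat.cast_zero]
  | succ k ih =>
    rw [pow_succ', coeff_hsymm_one_mul, card_word_succ, Nat.cast_sum]
    exact Finset.sum_congr rfl fun i _ => ih _

/-- The first factor of a monomial must be squarefree, and its degree selects a single `j`. The
bound by `n` remains because `j` stops there, and it keeps `n - p.1.degree` from being truncated. -/
theorem coeff_boolB (n : ℕ) (m : ℕ →₀ ℕ) :
    MvPowerSeries.coeff m (boolB n 1) =
      ∑ p ∈ (Finset.HasAntidiagonal.antidiagonal m).filter fun p => ∀ i, p.1 i ≤ 1,
        if p.1.degree ≤ n then (Nat.card (Word (n - p.1.degree) p.2) : ℂ) else 0 := by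
  have h : ∀ j ∈ Finset.range (n + 1), MvPowerSeries.coeff m
      ((1 : ℂ) ^ j • (esymm j * hsymmPart (Multiset.replicate (n - j) 1))) =
      ∑ p ∈ (Finset.HasAntidiagonal.antidiagonal m).filter fun p => ∀ i, p.1 i ≤ 1,
        if p.1.degree = j then (Nat.card (Word (n - j) p.2) : ℂ) else 0 := by
    intro j _
    rw [one_pow, one_smul, hsymmPart, Multiset.map_replicate, Multiset.prod_replicate,
      MvPowerSeries.coeff_mul, Finset.sum_filter]
    refine Finset.sum_congr rfl fun p _ => ?_
    rw [coeff_hsymm_one_pow, ← ite_and]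
    change (if (∀ i, p.1 i ≤ 1) ∧ p.1.degree = j then (1 : ℂ) else 0) * _ = _
    rw [ite_mul, one_mul, zero_mul]
  rw [boolB, map_sum, Finset.sum_congr rfl h, Finset.sum_comm]
  refine Finset.sum_congr rfl fun p _ => ?_
  rw [Finset.sum_ite_eq]
  simp only [Finset.mem_range, Nat.lt_succ_iff]

theorem coeff_boolB_of_degree_ne {n : ℕ} {m : ℕ →₀ ℕ} (hm : m.degree ≠ n) :
    MvPowerSeries.coeff m (boolB n 1) = 0 := by
  rw [coeff_boolB]
  refine Finset.sum_eq_zero fun p hp => ?_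
  have hp := Finset.HasAntidiagonal.mem_antidiagonal.1 (Finset.mem_filter.1 hp).1
  split_ifs with h
  · have : IsEmpty (Word (n - p.1.degree) p.2) := ⟨fun a => hm (by
      have := degree_eq_of_labelling a.2
      rw [← hp, map_add]
      omega)⟩
    rw [Nat.card_of_isEmpty, Nat.cast_zero]
  · rfl

theorem coeff_boolB_of_degree_eq {n : ℕ} {m : ℕ →₀ ℕ} (hm : m.degree = n) :
    MvPowerSeries.coeff m (boolB n 1) = Nat.card (LabelPair n m) := by
  rw [coeff_boolB, Nat.card_sigma, Nat.cast_sum, ← Finset.sum_coe_sort]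
  refine Finset.sum_congr rfl fun p _ => if_pos ?_
  have hp := Finset.HasAntidiagonal.mem_antidiagonal.1 (Finset.mem_filter.1 p.2).1
  have h := congrArg Finsupp.degree hp
  rw [map_add] at h
  omega

theorem frob_signedRep (n : ℕ) : frob (signedRep n) = boolB n 1 := by
  ext m
  by_cases hm : m.degree = n
  · obtain ⟨f, hf⟩ := exists_labelling hm
    rw [coeff_frob _ hf, finrank_invariantsOf_signedRep hf, coeff_boolB_of_degree_eq hm]
  · rw [coeff_frob_of_degree_ne _ hm, coeff_boolB_of_degree_ne hm]

end Positroid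
end

theorem proposition5p2 (n : ℕ) :
    (∃! ρ : Representation ℂ (Positroid.SymGrp n) (Positroid.P n →₀ ℂ),
      Positroid.IsSignedAction ρ) ∧
    (∀ ρ : Representation ℂ (Positroid.SymGrp n) (Positroid.P n →₀ ℂ),
      Positroid.IsSignedAction ρ → Positroid.frob ρ = Positroid.boolB n 1) ∧
    Positroid.boolB n 1 = ∑ j ∈ Finset.range (n + 1),
      Positroid.esymm j * Positroid.hsymmPart (Multiset.replicate (n - j) 1) := by
  refine ⟨⟨Positroid.signedRep n, Positroid.isSignedAction_signedRep n, fun ρ hρ =>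
    Positroid.eq_of_isSignedAction hρ (Positroid.isSignedAction_signedRep n)⟩, fun ρ hρ => ?_, ?_⟩
  · rw [Positroid.eq_of_isSignedAction hρ (Positroid.isSignedAction_signedRep n),
      Positroid.frob_signedRep]
  · simp [Positroid.boolB]
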